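/- Let $d\in\{2,3\}$, let $\Omega\subset\mathbb R^d$ be a bounded convex polygonal (polyhedral) domain, i.e. the nonempty interior of the convex hull of finitely many points, let $m\ge 1$ and $N\ge 0$ be integers and let $C_\sigma>0$. Then there is a constant $C>0$, depending only on $d,\Omega,m,N,C_\sigma$ (in particular not on the mesh size), with the following property. Let $\mathcal T_h$ be a conforming triangulation of $\Omega$ into finitely many closed $d$-simplices. For an element $K$ let $h_K$ be its diameter, $\rho_K$ the radius of its largest inscribed ball and $\boldsymbol x_K$ its barycenter; put $h=\max_K h_K$, $\rho=\min_K\rho_K$. Let $\mathcal E_h$ be the set of all interior and boundary $(d-1)$-dimensional faces, and $h_e=\operatorname{diam}(e)$ for $e\in\mathcal E_h$. For $K\in\mathcal T_h$ put $S_0(K)=\{K\}$, let $S_{t+1}(K)$ be the set of all elements that meet some element of $S_t(K)$, and let the patch $S(K)$ be $S_t(K)$ for the smallest $t\ge 0$ with $\#S_t(K)\ge N$. Let $I(K)=\{\boldsymbol x_{K'} : K'\in S(K)\}$, identify $S(K)$ also with the region $\bigcup_{K'\in S(K)}K'$, and let $\mathbb P_m$ be the space of polynomials of degree at most $m$. Assume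 that 1. $h\le C_\sigma\rho$; 2. $N\le \#\mathcal T_h$ (so that all patches are defined); 3. for every $K\in\mathcal T_h$ and $p\in\mathbb P_m$, if $p$ vanishes on $I(K)$, then $p$ vanishes on $S(K)$. Let $U_h^0$ be the space of functions that are constant on each element. For $v_h\in U_h^0$ and $K\in\mathcal T_h$ let $\mathcal R^m_Kv_h\in\mathbb P_m$ be the unique minimizer of $\sum_{\boldsymbol x\in I(K)}(p(\boldsymbol x)-v_h(\boldsymbol x))^2$ over all $p\in\mathbb P_m$ with $p(\boldsymbol x_K)=v_h(\boldsymbol x_K)$, and let $\mathcal R^mv_h$ be the piecewise polynomial function equal to $\mathcal R^m_Kv_h$ on each $K$. Put $$\Lambda_m=\max_{K\in\mathcal T_h}\ \max_{0\ne p\in\mathbb P_m}\frac{\max_{\boldsymbol x\in S(K)}|p(\boldsymbol x)|}{\max_{\boldsymbol x\in I(K)}|p(\boldsymbol x)|}.$$ For a piecewise smooth function $w$ let $$\|w\|_{DG}^2=\sum_{K\in\mathcal T_h}\|\nabla w\|_{L^2(K)}^2+\sum_{e\in\mathcal E_h}h_e^{-1}\|[\![w]\!]\|_{L^2(e)}^2,$$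 where the jump is $[\![w]\!]=w^+\mathbf n^++w^-\mathbf n^-$ on an interior face shared by $K^+$ and $K^-$, with unit outward normals $\mathbf n^\pm$ of $K^\pm$, and $[\![w]\!]=w\,\mathbf n$ on a boundary face, with $\mathbf n$ the unit outward normal. Then, for every $v_h\in U_h^0$, $$\|v_h\|_{DG}\le C\,\|\mathcal R^mv_h\|_{DG}\qquad\text{and}\qquad \|\mathcal R^mv_h\|_{DG}\le C\,\Lambda_m\,\|v_h\|_{DG}.$$ -/

import Mathlib

open MeasureTheory

noncomputable section

namespace ReconstructedDG

/-- The Euclidean space `ℝ^d`. -/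
abbrev Rd (d : ℕ) : Type := EuclideanSpace ℝ (Fin d)

/-- `Ω` is a bounded convex polygonal (polyhedral) domain: the nonempty interior of the convex hull
of finitely many points. -/
def IsConvexPolytopalDomain {d : ℕ} (Ω : Set (Rd d)) : Prop :=
  Ω.Nonempty ∧ ∃ V : Finset (Rd d), Ω = interior (convexHull ℝ (V : Set (Rd d)))

/-- A (conforming, simplicial) triangulation of `Ω`: a finite geometric simplicial complex whose
underlying space is the closure of `Ω`. -/
structure Triangulation {d : ℕ} (Ω : Set (Rd d)) extends
    Geometry.SimplicialComplex ℝ (Rd d) where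
  finite_faces : faces.Finite
  space_eq : (⋃ s ∈ faces, convexHull ℝ (s : Set (Rd d))) = closure Ω

/-- The closed simplex spanned by a finite set of vertices. -/
def hull {d : ℕ} (s : Finset (Rd d)) : Set (Rd d) := convexHull ℝ (s : Set (Rd d))

/-- The diameter `h_K` of an element or `h_e` of a face. -/
def hdiam {d : ℕ} (s : Finset (Rd d)) : ℝ := Metric.diam (hull s)

/-- The radius `ρ_K` of the largest ball inscribed in a simplex. -/
def inradius {d : ℕ} (s : Finset (Rd d)) : ℝ :=
  sSup {r : ℝ | 0 ≤ r ∧ ∃ x : Rd d, Metric.closedBall x r ⊆ hull s}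

/-- The barycenter of a simplex. -/
def barycenter {d : ℕ} (s : Finset (Rd d)) : Rd d := (s.card : ℝ)⁻¹ • ∑ x ∈ s, x

/-- The unit normal to the face `e` pointing out of the simplex `K`: the component orthogonal to
`e` of the vector from the barycenter of `K` to the barycenter of `e`, normalized. -/
def outwardNormal {d : ℕ} (K e : Finset (Rd d)) : Rd d :=
  let y : Rd d :=
    (vectorSpan ℝ (e : Set (Rd d)))ᗮ.starProjection (barycenter e - barycenter K)
  ‖y‖⁻¹ • y

/-- The value at `x` of a real polynomial in `d` variables. -/
def polyVal {d : ℕ} (p : MvPolynomial (Fin d) ℝ) (x : Rd d) : ℝ := MvPolynomial.eval (fun i => x i) p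

/-- `max_{x ∈ D} |p(x)|`. -/
def maxAbs {d : ℕ} (p : MvPolynomial (Fin d) ℝ) (D : Set (Rd d)) : ℝ :=
  sSup ((fun x => |polyVal p x|) '' D)

namespace Triangulation

variable {d : ℕ} {Ω : Set (Rd d)}

/-- The set of elements `𝒯_h`: the `d`-dimensional simplices. -/
def elements (T : Triangulation Ω) : Finset (Finset (Rd d)) :=
  T.finite_faces.toFinset.filter (fun s => s.card = d + 1)

/-- The set `ℰ_h` of all (interior and boundary) `(d-1)`-dimensional faces. -/
def facets (T : Triangulation Ω) : Finset (Finset (Rd d)) :=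
  T.finite_faces.toFinset.filter (fun s => s.card = d)

/-- The type of elements of the triangulation. -/
abbrev Elem (T : Triangulation Ω) : Type := {K : Finset (Rd d) // K ∈ T.elements}

/-- The mesh size `h = max_K h_K`. -/
def meshSize (T : Triangulation Ω) : ℝ := ⨆ K : T.Elem, hdiam K.1

/-- `ρ = min_K ρ_K`. -/
def minInradius (T : Triangulation Ω) : ℝ := ⨅ K : T.Elem, inradius K.1

open Classical in
/-- `Δ(K)`: the elements whose closure meets the closure of `K`. -/
def nbhd (T : Triangulation Ω) (K : T.Elem) : Finset T.Elem :=
  Finset.univ.filter (fun K' => (hull K.1 ∩ hull K'.1).Nonempty)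

open Classical in
/-- `S_t(K)`: the set of elements reached from `K` by `t` neighbour layers. -/
def layer (T : Triangulation Ω) (K : T.Elem) : ℕ → Finset T.Elem
  | 0 => {K}
  | t + 1 => (layer T K t).biUnion (T.nbhd)

/-- The element patch `S(K)` with threshold `N`: the layer `S_t(K)` for the first `t` such that
`# S_t(K) ≥ N`. -/
def patch (T : Triangulation Ω) (N : ℕ) (K : T.Elem) : Finset T.Elem :=
  T.layer K (sInf {t : ℕ | N ≤ (T.layer K t).card})

/-- The region covered by the (closed) elements of the patch `S(K)`. -/
def patchRegion (T : Triangulation Ω) (N : ℕ) (K : T.Elem) : Set (Rd d) :=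
  ⋃ K' ∈ T.patch N K, hull K'.1

/-- The collocation points `I(K)`: the barycenters of the elements of the patch `S(K)`. -/
def collocation (T : Triangulation Ω) (N : ℕ) (K : T.Elem) : Set (Rd d) :=
  {x | ∃ K' ∈ T.patch N K, x = barycenter K'.1}

/-- Unisolvence assumption: a polynomial of degree at most `m` vanishing at the collocation points
of a patch vanishes on the patch. -/
def Unisolvent (T : Triangulation Ω) (m N : ℕ) : Prop :=
  ∀ K : T.Elem, ∀ p : MvPolynomial (Fin d) ℝ, p.totalDegree ≤ m →
    (∀ x ∈ T.collocation N K, polyVal p x = 0) → ∀ x ∈ T.patchRegion N K, polyVal p x = 0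

/-- `Λ(m, K)`. The polynomial `0` contributes the harmless value `0 / 0 = 0`. -/
def LambdaLoc (T : Triangulation Ω) (m N : ℕ) (K : T.Elem) : ℝ :=
  ⨆ p : {p : MvPolynomial (Fin d) ℝ // p.totalDegree ≤ m},
    maxAbs p.1 (T.patchRegion N K) / maxAbs p.1 (T.collocation N K)

/-- `Λ_m = max_K Λ(m, K)`. -/
def Lambda (T : Triangulation Ω) (m N : ℕ) : ℝ := ⨆ K : T.Elem, T.LambdaLoc m N K

/-- The piecewise constant space `U_h^0`: a function is given by its value on each element. -/
abbrev PiecewiseConst (T : Triangulation Ω) : Type := T.Elem → ℝ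

/-- Piecewise smooth functions: a family of functions, of which the one with index `K` is used on
the closed simplex `K` only. The traces on a face from its two sides may be different. -/
abbrev Broken (T : Triangulation Ω) : Type := T.Elem → Rd d → ℝ

/-- A piecewise constant function as a piecewise smooth function. -/
def PiecewiseConst.toBroken {T : Triangulation Ω} (v : T.PiecewiseConst) : T.Broken :=
  fun K _ => v K

/-- The jump on the face `e`: the sum of `w|_K n_K` over the elements `K` having `e` as a face. There
are two such elements if `e` is an interior face and one if `e` lies on the boundary. -/
def jump (T : Triangulation Ω) (w : T.Broken) (e : Finset (Rd d)) (x : Rd d) : Rd d :=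
  open Classical in
  ∑ K : T.Elem with e ⊆ K.1, w K x • outwardNormal K.1 e

/-- The DG energy norm. -/
def energyNorm (T : Triangulation Ω) (w : T.Broken) : ℝ :=
  Real.sqrt
    ((∑ K : T.Elem, ∫ x in hull K.1, ‖gradient (w K) x‖ ^ 2) +
      ∑ e ∈ T.facets, (hdiam e)⁻¹ * ∫ x in hull e, ‖T.jump w e x‖ ^ 2 ∂μHE[d - 1])

/-- `p` solves the constrained least squares problem on the patch `S(K)`. Distinct elements have
distinct barycenters, so that the sum over `I(K)` is a sum over the elements of the patch. -/
def IsLeastSquaresSol (T : Triangulation Ω) (m N : ℕ) (v : T.PiecewiseConst) (K : T.Elem)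
    (p : MvPolynomial (Fin d) ℝ) : Prop :=
  (p.totalDegree ≤ m ∧ polyVal p (barycenter K.1) = v K) ∧
    ∀ q : MvPolynomial (Fin d) ℝ, q.totalDegree ≤ m → polyVal q (barycenter K.1) = v K →
      ∑ K' ∈ T.patch N K, (polyVal p (barycenter K'.1) - v K') ^ 2 ≤
        ∑ K' ∈ T.patch N K, (polyVal q (barycenter K'.1) - v K') ^ 2

theorem exists_leastSquaresSol (T : Triangulation Ω) (m N : ℕ) (v : T.PiecewiseConst)
    (K : T.Elem) : ∃ p, T.IsLeastSquaresSol m N v K p := by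
  let L : MvPolynomial (Fin d) ℝ →ₗ[ℝ] EuclideanSpace ℝ (T.patch N K) :=
    { toFun := fun p => WithLp.toLp 2 (fun K' => polyVal p (barycenter K'.1.1))
      map_add' := fun p q => by ext i; simp [polyVal]
      map_smul' := fun c p => by ext i; simp [polyVal] }
  let W : Submodule ℝ (MvPolynomial (Fin d) ℝ) :=
    { carrier := {p | p.totalDegree ≤ m ∧ polyVal p (barycenter K.1) = 0}
      add_mem' := fun {p q} hp hq =>
        ⟨(MvPolynomial.totalDegree_add p q).trans (max_le hp.1 hq.1), by
          have h1 := hp.2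
          have h2 := hq.2
          simp only [polyVal] at h1 h2 ⊢
          rw [map_add, h1, h2, add_zero]⟩
      zero_mem' := ⟨by simp, by simp [polyVal]⟩
      smul_mem' := fun c p hp =>
        ⟨(MvPolynomial.totalDegree_smul_le c p).trans hp.1, by
          have h1 := hp.2
          simp only [polyVal] at h1 ⊢
          rw [MvPolynomial.smul_eval, h1, mul_zero]⟩ }
  let y : EuclideanSpace ℝ (T.patch N K) := WithLp.toLp 2 (fun K' => v K'.1 - v K)
  obtain ⟨q₀, hq₀, hq₀'⟩ := ((W.map L).starProjection_apply_mem y)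
  have key : ∀ r : MvPolynomial (Fin d) ℝ,
      ∑ K' ∈ T.patch N K, (polyVal (r + MvPolynomial.C (v K)) (barycenter K'.1) - v K') ^ 2
        = ‖y - L r‖ ^ 2 := by
    intro r
    rw [EuclideanSpace.norm_sq_eq, ← Finset.sum_coe_sort]
    refine Finset.sum_congr rfl fun i _ => ?_
    simp only [polyVal, map_add, MvPolynomial.eval_C, PiLp.sub_apply, Real.norm_eq_abs, sq_abs,
      y, L, LinearMap.coe_mk, AddHom.coe_mk]
    ring
  refine ⟨q₀ + MvPolynomial.C (v K), ⟨?_, ?_⟩, ?_⟩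
  · exact (MvPolynomial.totalDegree_add _ _).trans (max_le hq₀.1 (by simp))
  · have h1 := hq₀.2
    simp only [polyVal] at h1 ⊢
    rw [map_add, h1, MvPolynomial.eval_C, zero_add]
  · intro q hq hqK
    have hr : q - MvPolynomial.C (v K) ∈ W := by
      refine ⟨(MvPolynomial.totalDegree_sub _ _).trans (max_le hq (by simp)), ?_⟩
      simp only [polyVal] at hqK ⊢
      rw [map_sub, hqK, MvPolynomial.eval_C, sub_self]
    have h2 := key (q - MvPolynomial.C (v K))
    rw [sub_add_cancel] at h2
    rw [key, h2, hq₀', Submodule.starProjection_minimal]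
    refine pow_le_pow_left₀ (Real.iInf_nonneg fun _ => norm_nonneg _) ?_ 2
    exact ciInf_le (f := fun z : W.map L => ‖y - z‖)
      ⟨0, by rintro _ ⟨z, rfl⟩; exact norm_nonneg (y - (z : EuclideanSpace ℝ (T.patch N K)))⟩
      (⟨L (q - MvPolynomial.C (v K)), ⟨_, hr, rfl⟩⟩ : W.map L)

/-- The local reconstruction `ℛ_K^m v`: the solution of the constrained least squares problem (it
is unique under the unisolvence assumption). -/
def localRecon (T : Triangulation Ω) (m N : ℕ) (v : T.PiecewiseConst) (K : T.Elem) :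
    MvPolynomial (Fin d) ℝ :=
  Classical.choose (T.exists_leastSquaresSol m N v K)

/-- The reconstruction `ℛ^m v`, equal to `ℛ_K^m v` on the element `K`. -/
def recon (T : Triangulation Ω) (m N : ℕ) (v : T.PiecewiseConst) : T.Broken :=
  fun K => polyVal (T.localRecon m N v K)

end Triangulation

end ReconstructedDG

end

/-! For piecewise constant `v` the DG norm consists of jumps alone, so both bounds reduce to
comparing `v` with its reconstruction `w` element by element. Quasi-uniformity gives every element
diameter at most `h` and an inscribed ball of radius `c * h`. Hence, after scaling to unit size,
norms on polynomials of degree at most `m` are equivalent with mesh-independent constants, and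
`h_e⁻¹ |e|` is comparable to `h ^ (d - 2)`. If two broken functions differ by at most `√(B K)` on
`K`, their facet energies differ, up to constants, by `h ^ (d - 2) * ∑ B K` (`sum_facetPart_le`);
this is used in both directions.

Lower bound: the constraint `w(x_K) = v_K` makes `w - v_K` no larger than the oscillation of `w` on
`K`, and `h ^ (d - 2)` times its square is bounded by the gradient energy on `K`
(`exists_oscillation_le`).

Stability: minimality against the competitor `v_K` bounds `w - v_K` at the collocation points by the
differences `v_K - v_L` over the patch. The factor `Λ_m` carries this to the whole patch
(`recon_sub_sq_le`), and an inverse inequality bounds the gradient (`exists_integral_gradient_le`).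

What remains is a discrete Poincaré estimate (`sum_sum_sq_sub_le`): differences over a patch are
controlled by jumps. A patch has at most `N` layers, so it lies in a ball of radius `(N + 1) * h`.
Since `Ω` is convex, a generic segment from `K` to `L` stays in `closure Ω` and misses all faces of
dimension at most `d - 2`; the elements it meets are therefore connected through common facets.
Comparing volumes bounds both the length of such a chain and how often each jump is counted. -/

noncomputable section

namespace ReconstructedDG

open Metric

/-! ### Polynomials of bounded degree: norm equivalence, scaling and inverse inequalities -/

section

/-- On a finite-dimensional space, every linear map is bounded in the norm induced by an injective
linear map. -/
theorem exists_norm_le_of_injective {V E F : Type*} [AddCommGroup V] [Module ℝ V]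
    [FiniteDimensional ℝ V] [NormedAddCommGroup E] [NormedSpace ℝ E] [NormedAddCommGroup F]
    [NormedSpace ℝ F] (Φ : V →ₗ[ℝ] E) (hΦ : Function.Injective Φ) (Ψ : V →ₗ[ℝ] F) :
    ∃ C : ℝ, 0 < C ∧ ∀ v, ‖Ψ v‖ ≤ C * ‖Φ v‖ := by
  let e := LinearEquiv.ofInjective Φ hΦ
  -- `Ψ ∘ Φ⁻¹` lives on the finite-dimensional range of `Φ`, so it is automatically continuous.
  let g : LinearMap.range Φ →L[ℝ] F := LinearMap.toContinuousLinearMap (Ψ ∘ₗ e.symm.toLinearMap)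
  refine ⟨‖g‖ + 1, by positivity, fun v => ?_⟩
  have h := g.le_opNorm (e v)
  have h1 : g (e v) = Ψ v := by simp [g]
  have h2 : ‖e v‖ = ‖Φ v‖ := rfl
  rw [h1, h2] at h
  nlinarith [norm_nonneg (Φ v)]

variable {d : ℕ}

theorem continuous_polyVal (p : MvPolynomial (Fin d) ℝ) : Continuous (polyVal p) :=
  (MvPolynomial.continuous_eval p).comp (by fun_prop)

theorem hasFDerivAt_polyVal (p : MvPolynomial (Fin d) ℝ) (x : Rd d) :
    HasFDerivAt (polyVal p)
      (∑ i, polyVal (MvPolynomial.pderiv i p) x • (EuclideanSpace.proj i : Rd d →L[ℝ] ℝ)) x := by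
  induction p using MvPolynomial.induction_on with
  | C a =>
    have h : polyVal (MvPolynomial.C a) = fun _ : Rd d => a := by ext y; simp [polyVal]
    refine HasFDerivAt.congr_fderiv (f' := 0) (h ▸ hasFDerivAt_const a x) ?_
    simp [polyVal]
  | add p q hp hq =>
    have := hp.add hq
    convert! this using 1
    · ext y; simp [polyVal]
    · simp [polyVal, add_smul, Finset.sum_add_distrib]
  | mul_X p j hp =>
    have hj : HasFDerivAt (fun y : Rd d => y j) (EuclideanSpace.proj j : Rd d →L[ℝ] ℝ) x :=
      (EuclideanSpace.proj j : Rd d →L[ℝ] ℝ).hasFDerivAt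
    have := hp.mul hj
    convert! this using 1
    · ext y; simp [polyVal]
    · ext y
      simp [polyVal, MvPolynomial.pderiv_X, add_mul, Finset.sum_add_distrib,
        Finset.mul_sum, Pi.single_apply, apply_ite, ite_mul]
      exact Finset.sum_congr rfl fun i _ => by ring

theorem hasGradientAt_polyVal (p : MvPolynomial (Fin d) ℝ) (x : Rd d) :
    HasGradientAt (polyVal p)
      (WithLp.toLp 2 fun i => polyVal (MvPolynomial.pderiv i p) x) x := by
  rw [hasGradientAt_iff_hasFDerivAt]
  refine (hasFDerivAt_polyVal p x).congr_fderiv ?_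
  ext y
  simp [PiLp.inner_apply, mul_comm]

theorem norm_sq_gradient_polyVal (p : MvPolynomial (Fin d) ℝ) (x : Rd d) :
    ‖gradient (polyVal p) x‖ ^ 2 = ∑ i, polyVal (MvPolynomial.pderiv i p) x ^ 2 := by
  rw [(hasGradientAt_polyVal p x).gradient, EuclideanSpace.norm_sq_eq]
  simp

theorem continuous_norm_sq_gradient_polyVal (p : MvPolynomial (Fin d) ℝ) :
    Continuous fun x => ‖gradient (polyVal p) x‖ ^ 2 := by
  simp_rw [norm_sq_gradient_polyVal]
  exact continuous_finsetSum _ fun i _ => (continuous_polyVal _).pow 2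

theorem gradient_polyVal_sub_C (p : MvPolynomial (Fin d) ℝ) (a : ℝ) (x : Rd d) :
    gradient (polyVal (p - MvPolynomial.C a)) x = gradient (polyVal p) x := by
  rw [(hasGradientAt_polyVal _ x).gradient, (hasGradientAt_polyVal p x).gradient]
  simp

theorem totalDegree_pderiv_le (p : MvPolynomial (Fin d) ℝ) (i : Fin d) :
    (MvPolynomial.pderiv i p).totalDegree ≤ p.totalDegree := by
  conv_lhs => rw [p.as_sum, map_sum]
  refine (MvPolynomial.totalDegree_finsetSum _ _).trans (Finset.sup_le fun s hs => ?_)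
  rw [MvPolynomial.pderiv_monomial]
  refine (MvPolynomial.totalDegree_monomial_le _ _).trans ?_
  refine le_trans ?_ (MvPolynomial.le_totalDegree hs)
  rw [Finsupp.sum_fintype _ _ fun _ => rfl, Finsupp.sum_fintype _ _ fun _ => rfl]
  exact Finset.sum_le_sum fun j _ => by simp

/-- A polynomial vanishing on a ball is zero. -/
theorem eq_zero_of_polyVal_eq_zero {p : MvPolynomial (Fin d) ℝ} {x : Rd d} {r : ℝ} (hr : 0 < r)
    (h : ∀ y ∈ ball x r, polyVal p y = 0) : p = 0 := by
  have ho : IsOpen ((WithLp.toLp 2 : (Fin d → ℝ) → Rd d) ⁻¹' ball x r) :=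
    isOpen_ball.preimage (PiLp.continuous_toLp 2 _)
  obtain ⟨ε, hε, hb⟩ := Metric.isOpen_iff.1 ho (fun i => x i) (by simpa using hr)
  -- The ball contains a box around its centre, and a polynomial vanishing on a product of infinite
  -- sets is zero.
  refine MvPolynomial.funext_set (fun i => ball (x i) ε) (fun i => ?_) fun y hy => ?_
  · rw [Real.ball_eq_Ioo]
    exact Set.Ioo_infinite (by linarith)
  · rw [← ball_pi _ hε] at hy
    simpa [polyVal] using h _ (hb hy)

/-- Composition of a polynomial with a homothety and a translation. -/
def affinePullback (a : Rd d) (h : ℝ) (p : MvPolynomial (Fin d) ℝ) : MvPolynomial (Fin d) ℝ :=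
  MvPolynomial.aeval (fun i => MvPolynomial.C (a i) + MvPolynomial.C h * MvPolynomial.X i) p

theorem polyVal_affinePullback (a : Rd d) (h : ℝ) (p : MvPolynomial (Fin d) ℝ) (y : Rd d) :
    polyVal (affinePullback a h p) y = polyVal p (a + h • y) := by
  unfold polyVal
  induction p using MvPolynomial.induction_on with
  | C a => simp [affinePullback]
  | add p q hp hq =>
    rw [affinePullback] at hp hq ⊢
    rw [map_add, map_add, map_add, hp, hq]
  | mul_X p j hp =>
    rw [affinePullback] at hp ⊢
    rw [map_mul, map_mul, map_mul, hp]
    simp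

theorem totalDegree_affinePullback_le (a : Rd d) (h : ℝ) (p : MvPolynomial (Fin d) ℝ) :
    (affinePullback a h p).totalDegree ≤ p.totalDegree := by
  unfold affinePullback
  conv_lhs => rw [p.as_sum, map_sum]
  refine (MvPolynomial.totalDegree_finsetSum _ _).trans (Finset.sup_le fun s hs => ?_)
  refine le_trans ?_ (MvPolynomial.le_totalDegree hs)
  rw [MvPolynomial.aeval_monomial]
  refine (MvPolynomial.totalDegree_mul _ _).trans ?_
  rw [MvPolynomial.algebraMap_eq, MvPolynomial.totalDegree_C, zero_add]
  refine (MvPolynomial.totalDegree_finsetProd _ _).trans (Finset.sum_le_sum fun i _ => ?_)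
  refine (MvPolynomial.totalDegree_pow _ _).trans ?_
  have h1 : (MvPolynomial.C (a i) + MvPolynomial.C h * MvPolynomial.X i :
      MvPolynomial (Fin d) ℝ).totalDegree ≤ 1 := by
    refine (MvPolynomial.totalDegree_add _ _).trans (max_le (by simp) ?_)
    refine (MvPolynomial.totalDegree_mul _ _).trans ?_
    simp
  nlinarith

theorem gradient_affinePullback (a : Rd d) (h : ℝ) (p : MvPolynomial (Fin d) ℝ) (y : Rd d) :
    gradient (polyVal (affinePullback a h p)) y = h • gradient (polyVal p) (a + h • y) := by
  refine HasGradientAt.gradient ?_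
  have h1 := hasFDerivAt_polyVal p (a + h • y)
  have h2 : HasFDerivAt (fun y : Rd d => a + h • y) (h • ContinuousLinearMap.id ℝ (Rd d)) y :=
    ((hasFDerivAt_id y).const_smul h).const_add a
  have h3 := h1.comp y h2
  rw [hasGradientAt_iff_hasFDerivAt,
    show polyVal (affinePullback a h p) = polyVal p ∘ fun y => a + h • y from
      funext (polyVal_affinePullback a h p)]
  refine h3.congr_fderiv ?_
  rw [(hasGradientAt_polyVal p _).gradient]
  ext z
  simp [PiLp.inner_apply, Finset.mul_sum]
  exact Finset.sum_congr rfl fun i _ => by ring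

/-- Restriction of polynomials of bounded degree to a closed ball. -/
def restrictBall (m : ℕ) (r : ℝ) :
    MvPolynomial.restrictTotalDegree (Fin d) ℝ m →ₗ[ℝ] C(closedBall (0 : Rd d) r, ℝ) where
  toFun p := ⟨fun x => polyVal p.1 x.1, (continuous_polyVal _).comp continuous_subtype_val⟩
  map_add' p q := by ext; simp [polyVal]
  map_smul' c p := by ext; simp [polyVal]

/-- The partial derivative on polynomials of bounded degree. -/
def pderivRestrict (m : ℕ) (i : Fin d) :
    MvPolynomial.restrictTotalDegree (Fin d) ℝ m →ₗ[ℝ]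
      MvPolynomial.restrictTotalDegree (Fin d) ℝ m :=
  (MvPolynomial.pderiv i).toLinearMap.restrict fun p hp => by
    rw [MvPolynomial.mem_restrictTotalDegree] at hp ⊢
    exact (totalDegree_pderiv_le p i).trans hp

theorem restrictBall_injective (m : ℕ) {r : ℝ} (hr : 0 < r) :
    Function.Injective (restrictBall (d := d) m r) := by
  rw [injective_iff_map_eq_zero]
  intro p hp
  ext1
  refine eq_zero_of_polyVal_eq_zero (x := 0) hr fun y hy => ?_
  exact congrArg (fun f => f ⟨y, ball_subset_closedBall hy⟩) hp

theorem memLp_two_polyVal (p : MvPolynomial (Fin d) ℝ) (r : ℝ) :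
    MemLp (polyVal p) 2 (volume.restrict (closedBall (0 : Rd d) r)) :=
  (memLp_two_iff_integrable_sq (continuous_polyVal p).aestronglyMeasurable).2
    (((continuous_polyVal p).pow 2).continuousOn.integrableOn_compact (isCompact_closedBall _ _))

/-- Restriction of polynomials of bounded degree to a closed ball, as a map to `L²`. -/
def restrictBallLp (m : ℕ) (r : ℝ) :
    MvPolynomial.restrictTotalDegree (Fin d) ℝ m →ₗ[ℝ]
      Lp ℝ 2 (volume.restrict (closedBall (0 : Rd d) r)) where
  toFun p := MemLp.toLp (polyVal p.1) (memLp_two_polyVal p.1 r)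
  map_add' p q := by
    rw [← MemLp.toLp_add]
    exact MemLp.toLp_congr _ _ (Filter.Eventually.of_forall fun x => by simp [polyVal])
  map_smul' c p := by
    rw [RingHom.id_apply, ← MemLp.toLp_const_smul]
    exact MemLp.toLp_congr _ _ (.of_forall fun x => by simp [polyVal])

theorem coeFn_restrictBallLp (m : ℕ) (r : ℝ)
    (p : MvPolynomial.restrictTotalDegree (Fin d) ℝ m) :
    restrictBallLp m r p =ᵐ[volume.restrict (closedBall (0 : Rd d) r)] polyVal p.1 :=
  MemLp.coeFn_toLp (memLp_two_polyVal p.1 r)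

theorem norm_sq_restrictBallLp (m : ℕ) (r : ℝ)
    (p : MvPolynomial.restrictTotalDegree (Fin d) ℝ m) :
    ‖restrictBallLp m r p‖ ^ 2 = ∫ x in closedBall (0 : Rd d) r, polyVal p.1 x ^ 2 := by
  rw [← real_inner_self_eq_norm_sq, L2.inner_def]
  refine integral_congr_ae ?_
  have h := coeFn_restrictBallLp m r p
  filter_upwards [h] with x hx
  rw [hx]
  simp [sq]

/-- A continuous function vanishing almost everywhere on an open ball vanishes on it. This makes the
`L²` norm on a small ball a norm on the polynomials, to be compared with the maximum norm on the
unit ball. -/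
theorem restrictBallLp_injective (m : ℕ) {r : ℝ} (hr : 0 < r) :
    Function.Injective (restrictBallLp (d := d) m r) := by
  rw [injective_iff_map_eq_zero]
  intro p hp
  ext1
  have h := coeFn_restrictBallLp m r p
  rw [hp] at h
  have h0 : polyVal p.1 =ᵐ[volume.restrict (ball (0 : Rd d) r)] 0 :=
    ae_restrict_of_ae_restrict_of_subset ball_subset_closedBall
      (h.symm.trans (Lp.coeFn_zero _ _ _))
  have h1 : Set.EqOn (polyVal p.1) 0 (ball (0 : Rd d) r) :=
    Measure.eqOn_open_of_ae_eq h0 isOpen_ball (continuous_polyVal _).continuousOn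
      continuousOn_const
  exact eq_zero_of_polyVal_eq_zero hr fun y hy => h1 hy

/-- On polynomials of bounded degree, the maximum over a large ball is bounded by the `L²` norm over
a small one. -/
theorem exists_polyVal_sq_le_integral (d m : ℕ) {c : ℝ} (hc : 0 < c) :
    ∃ C : ℝ, 0 < C ∧ ∀ p : MvPolynomial (Fin d) ℝ, p.totalDegree ≤ m →
      ∀ y ∈ closedBall (0 : Rd d) 1,
        polyVal p y ^ 2 ≤ C * ∫ x in closedBall (0 : Rd d) c, polyVal p x ^ 2 := by
  obtain ⟨C, hC, h⟩ := exists_norm_le_of_injective (restrictBallLp (d := d) m c)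
    (restrictBallLp_injective m hc) (restrictBall m 1)
  refine ⟨C ^ 2, by positivity, fun p hp y hy => ?_⟩
  let q : MvPolynomial.restrictTotalDegree (Fin d) ℝ m :=
    ⟨p, (MvPolynomial.mem_restrictTotalDegree _ _ _).2 hp⟩
  have h1 := h q
  have h2 := ContinuousMap.norm_coe_le_norm (restrictBall m 1 q) ⟨y, hy⟩
  have h3 : |polyVal p y| ≤ C * ‖restrictBallLp m c q‖ := h2.trans h1
  have h4 := pow_le_pow_left₀ (abs_nonneg _) h3 2
  rwa [sq_abs, mul_pow, norm_sq_restrictBallLp] at h4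

theorem exists_gradient_sq_le_integral (d m : ℕ) {c : ℝ} (hc : 0 < c) :
    ∃ C : ℝ, 0 < C ∧ ∀ p : MvPolynomial (Fin d) ℝ, p.totalDegree ≤ m →
      ∀ y ∈ closedBall (0 : Rd d) 1, ‖gradient (polyVal p) y‖ ^ 2 ≤
        C * ∫ x in closedBall (0 : Rd d) c, ‖gradient (polyVal p) x‖ ^ 2 := by
  obtain ⟨C, hC, h⟩ := exists_polyVal_sq_le_integral d m hc
  refine ⟨C, hC, fun p hp y hy => ?_⟩
  simp_rw [norm_sq_gradient_polyVal]
  rw [integral_finsetSum (f := fun i x => polyVal (MvPolynomial.pderiv i p) x ^ 2) _ fun i _ =>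
    ((continuous_polyVal _).pow 2).continuousOn.integrableOn_compact (isCompact_closedBall _ _),
    Finset.mul_sum]
  exact Finset.sum_le_sum fun i _ => h _ ((totalDegree_pderiv_le p i).trans hp) y hy

/-- Markov's inequality: the derivatives of a polynomial of bounded degree on a large ball are bounded
by the maximum of the polynomial on a small one. -/
theorem exists_pderiv_sq_le (d m : ℕ) {c : ℝ} (hc : 0 < c) :
    ∃ C : ℝ, 0 < C ∧ ∀ p : MvPolynomial (Fin d) ℝ, p.totalDegree ≤ m → ∀ B : ℝ,
      (∀ x ∈ closedBall (0 : Rd d) c, polyVal p x ^ 2 ≤ B) →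
        ∀ y ∈ closedBall (0 : Rd d) 1, ‖gradient (polyVal p) y‖ ^ 2 ≤ C * B := by
  have (i : Fin d) := exists_norm_le_of_injective (restrictBall (d := d) m c)
    (restrictBall_injective m hc) (restrictBall m 1 ∘ₗ pderivRestrict m i)
  choose C hC h using this
  refine ⟨∑ i, C i ^ 2 + 1, by positivity, fun p hp B hB y hy => ?_⟩
  have hB0 : 0 ≤ B := (sq_nonneg _).trans (hB 0 (by simp [hc.le]))
  let q : MvPolynomial.restrictTotalDegree (Fin d) ℝ m :=
    ⟨p, (MvPolynomial.mem_restrictTotalDegree _ _ _).2 hp⟩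
  have h0 : ‖restrictBall m c q‖ ≤ √B := by
    rw [ContinuousMap.norm_le _ (Real.sqrt_nonneg _)]
    intro x
    exact Real.abs_le_sqrt (hB x.1 x.2)
  rw [norm_sq_gradient_polyVal, add_mul, Finset.sum_mul]
  refine le_add_of_le_of_nonneg (Finset.sum_le_sum fun i _ => ?_) (by positivity)
  have h2 := ContinuousMap.norm_coe_le_norm (restrictBall m 1 (pderivRestrict m i q)) ⟨y, hy⟩
  have h3 : |polyVal (MvPolynomial.pderiv i p) y| ≤ C i * √B :=
    h2.trans ((h i q).trans (mul_le_mul_of_nonneg_left h0 (hC i).le))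
  have h4 := pow_le_pow_left₀ (abs_nonneg _) h3 2
  rwa [sq_abs, mul_pow, Real.sq_sqrt hB0] at h4

/-- Inverse inequality bounding the oscillation of a polynomial on a shape regular convex set by its
gradient. -/
theorem exists_oscillation_le (d m : ℕ) (hd : 2 ≤ d) {c : ℝ} (hc : 0 < c) :
    ∃ C : ℝ, 0 < C ∧ ∀ (S : Set (Rd d)) (a : Rd d) (h : ℝ), 0 < h → Convex ℝ S → IsCompact S →
      closedBall a (c * h) ⊆ S → S ⊆ closedBall a h →
      ∀ p : MvPolynomial (Fin d) ℝ, p.totalDegree ≤ m → ∀ x ∈ S, ∀ y ∈ S,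
        h ^ (d - 2) * (polyVal p x - polyVal p y) ^ 2 ≤
          C * ∫ z in S, ‖gradient (polyVal p) z‖ ^ 2 := by
  obtain ⟨C, hC, hp⟩ := exists_gradient_sq_le_integral d m hc
  refine ⟨4 * C, by positivity, fun S a h hh hS hSc hcS hSh p hpm x hx y hy => ?_⟩
  set I := ∫ z in S, ‖gradient (polyVal p) z‖ ^ 2 with hI
  have hgrad : ∀ z ∈ S, h ^ d * ‖gradient (polyVal p) z‖ ^ 2 ≤ C * I := by
    intro z hz
    -- The unit-size estimate is applied to `y ↦ p (a + h y)`: the chain rule gives `h ^ 2` on both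
    -- sides, which cancels, and the change of variables leaves `h ^ d`.
    have h1 := hp (affinePullback a h p) ((totalDegree_affinePullback_le _ _ _).trans hpm)
      (h⁻¹ • (z - a)) (by
        have := mem_closedBall.1 (hSh hz)
        rw [mem_closedBall_zero_iff, norm_smul, ← dist_eq_norm, norm_inv, Real.norm_eq_abs,
          abs_of_pos hh, inv_mul_le_iff₀ hh]
        linarith)
    simp_rw [gradient_affinePullback] at h1
    rw [smul_inv_smul₀ hh.ne', add_sub_cancel] at h1
    simp_rw [norm_smul, mul_pow, Real.norm_eq_abs, sq_abs] at h1
    rw [integral_const_mul, Measure.setIntegral_comp_smul_of_pos volume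
      (fun x => ‖gradient (polyVal p) (a + x)‖ ^ 2) _ hh, _root_.smul_closedBall _ _ (by positivity),
      smul_zero, finrank_euclideanSpace_fin, Real.norm_eq_abs, abs_of_pos hh] at h1
    have h2 : ∫ x in closedBall (0 : Rd d) (h * c), ‖gradient (polyVal p) (a + x)‖ ^ 2 =
        ∫ x in closedBall a (c * h), ‖gradient (polyVal p) x‖ ^ 2 := by
      rw [← (measurePreserving_add_left volume a).setIntegral_preimage_emb
        (measurableEmbedding_addLeft a) _ (closedBall a (c * h)), preimage_add_closedBall, sub_self,
        mul_comm]
    rw [h2, smul_eq_mul] at h1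
    have h3 : ∫ x in closedBall a (c * h), ‖gradient (polyVal p) x‖ ^ 2 ≤ I :=
      setIntegral_mono_set ((continuous_norm_sq_gradient_polyVal p).continuousOn.integrableOn_compact
        hSc) (Filter.Eventually.of_forall fun _ => by positivity) hcS.eventuallyLE
    have h4 : h ^ 2 * ‖gradient (polyVal p) z‖ ^ 2 ≤ C * (h ^ 2 * ((h ^ d)⁻¹ * I)) :=
      h1.trans (by gcongr)
    have h5 : C * (h ^ 2 * ((h ^ d)⁻¹ * I)) = h ^ 2 * ((h ^ d)⁻¹ * (C * I)) := by ring
    rw [h5] at h4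
    have h6 := le_of_mul_le_mul_left h4 (by positivity)
    rwa [← div_eq_inv_mul, le_div_iff₀ (by positivity), mul_comm] at h6
  have hI0 : 0 ≤ I := integral_nonneg fun _ => by positivity
  set G := √(C * I / h ^ d) with hG
  have hlip : ∀ z ∈ S, ‖fderiv ℝ (polyVal p) z‖ ≤ G := by
    intro z hz
    have h1 : ‖fderiv ℝ (polyVal p) z‖ = ‖gradient (polyVal p) z‖ := by
      rw [gradient, LinearIsometryEquiv.norm_map]
    rw [h1]
    refine Real.le_sqrt_of_sq_le ?_
    rw [le_div_iff₀ (by positivity), mul_comm]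
    exact hgrad z hz
  -- Convexity of `S` turns the pointwise gradient bound into a Lipschitz bound. Together with `‖x -
  -- y‖ ≤ 2 * h` this produces the factor 4 in the constant.
  have hmv := hS.norm_image_sub_le_of_norm_fderiv_le
    (fun z _ => (hasFDerivAt_polyVal p z).differentiableAt) hlip hy hx
  have hxy : ‖x - y‖ ≤ 2 * h := by
    rw [← dist_eq_norm]
    have h1 := mem_closedBall.1 (hSh hx)
    have h2 := mem_closedBall'.1 (hSh hy)
    linarith [dist_triangle x a y]
  have h5 : |polyVal p x - polyVal p y| ≤ G * (2 * h) :=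
    hmv.trans (mul_le_mul_of_nonneg_left hxy (Real.sqrt_nonneg _))
  have h6 := pow_le_pow_left₀ (abs_nonneg _) h5 2
  rw [sq_abs, mul_pow, Real.sq_sqrt (by positivity)] at h6
  calc h ^ (d - 2) * (polyVal p x - polyVal p y) ^ 2
      ≤ h ^ (d - 2) * (C * I / h ^ d * (2 * h) ^ 2) := by gcongr
    _ = 4 * C * I := by
      obtain ⟨k, rfl⟩ := Nat.exists_eq_add_of_le' hd
      rw [Nat.add_sub_cancel]
      field_simp
      ring

/-- Inverse inequality bounding the gradient of a polynomial on a shape regular set by its maximum. -/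
theorem exists_integral_gradient_le (d m : ℕ) (hd : 2 ≤ d) {c : ℝ} (hc : 0 < c) :
    ∃ C : ℝ, 0 < C ∧ ∀ (S : Set (Rd d)) (a : Rd d) (h : ℝ), 0 < h →
      closedBall a (c * h) ⊆ S → S ⊆ closedBall a h →
      ∀ p : MvPolynomial (Fin d) ℝ, p.totalDegree ≤ m → ∀ b B : ℝ,
        (∀ x ∈ S, (polyVal p x - b) ^ 2 ≤ B) →
        ∫ z in S, ‖gradient (polyVal p) z‖ ^ 2 ≤ C * (h ^ (d - 2) * B) := by
  obtain ⟨C, hC, hp⟩ := exists_pderiv_sq_le d m hc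
  refine ⟨C * (volume.real (closedBall (0 : Rd d) 1) + 1), by positivity,
    fun S a h hh hcS hSh p hpm b B hB => ?_⟩
  have ha : a ∈ S := hcS (by simp; positivity)
  have hB0 : 0 ≤ B := (sq_nonneg _).trans (hB a ha)
  have hgrad : ∀ z ∈ S, ‖gradient (polyVal p) z‖ ^ 2 ≤ C * B / h ^ 2 := by
    intro z hz
    -- Subtracting `b` does not change the gradient; the factor `h` from the chain rule is what
    -- leaves `h ^ 2` in the denominator.
    have h1 := hp (affinePullback a h (p - MvPolynomial.C b))
      ((totalDegree_affinePullback_le _ _ _).trans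
        ((MvPolynomial.totalDegree_sub _ _).trans (max_le hpm (by simp)))) B (fun x hx => by
          rw [polyVal_affinePullback]
          have := hB (a + h • x) (hcS (by
            rw [mem_closedBall_zero_iff] at hx
            simp only [mem_closedBall, dist_self_add_left, norm_smul, Real.norm_eq_abs,
              abs_of_pos hh]
            nlinarith))
          simpa [polyVal] using this) (h⁻¹ • (z - a)) (by
            have := mem_closedBall.1 (hSh hz)
            rw [mem_closedBall_zero_iff, norm_smul, ← dist_eq_norm, norm_inv, Real.norm_eq_abs,
              abs_of_pos hh, inv_mul_le_iff₀ hh]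
            linarith)
    rw [gradient_affinePullback, smul_inv_smul₀ hh.ne', add_sub_cancel, gradient_polyVal_sub_C,
      norm_smul, mul_pow, Real.norm_eq_abs, sq_abs] at h1
    rw [le_div_iff₀ (by positivity)]
    linarith
  have hvol : volume.real S ≤ h ^ d * volume.real (closedBall (0 : Rd d) 1) := by
    have h1 := Measure.addHaar_real_closedBall' (volume : Measure (Rd d)) a hh.le
    rw [finrank_euclideanSpace_fin] at h1
    rw [← h1]
    exact measureReal_mono hSh (measure_closedBall_lt_top.ne)
  have hfin : volume S < ⊤ := (measure_mono hSh).trans_lt measure_closedBall_lt_top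
  have h2 : ∫ z in S, ‖gradient (polyVal p) z‖ ^ 2 ≤ C * B / h ^ 2 * volume.real S := by
    have := norm_setIntegral_le_of_norm_le_const hfin (f := fun z => ‖gradient (polyVal p) z‖ ^ 2)
      (C := C * B / h ^ 2) (fun z hz => by
        rw [Real.norm_eq_abs, abs_of_nonneg (by positivity)]; exact hgrad z hz)
    exact (le_abs_self _).trans this
  refine h2.trans ?_
  calc C * B / h ^ 2 * volume.real S
      ≤ C * B / h ^ 2 * (h ^ d * volume.real (closedBall (0 : Rd d) 1)) := by gcongr
    _ = C * volume.real (closedBall (0 : Rd d) 1) * (h ^ (d - 2) * B) := by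
      obtain ⟨k, rfl⟩ := Nat.exists_eq_add_of_le' hd
      rw [Nat.add_sub_cancel]
      field_simp
      ring
    _ ≤ _ := by gcongr; linarith

end

/-! ### Geometry of a simplex and its facets: measures and normals -/

section

variable {d : ℕ}

theorem isCompact_hull (s : Finset (Rd d)) : IsCompact (hull s) :=
  s.finite_toSet.isCompact_convexHull ℝ

theorem convex_hull (s : Finset (Rd d)) : Convex ℝ (hull s) := convex_convexHull ℝ _

theorem hull_mono {s t : Finset (Rd d)} (h : s ⊆ t) : hull s ⊆ hull t :=
  convexHull_mono (Finset.coe_subset.2 h)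

theorem hull_subset_affineSpan (s : Finset (Rd d)) :
    hull s ⊆ affineSpan ℝ (s : Set (Rd d)) := convexHull_subset_affineSpan _

theorem sub_mem_vectorSpan_of_mem_hull {s : Finset (Rd d)} {x y : Rd d} (hx : x ∈ hull s)
    (hy : y ∈ hull s) : x - y ∈ vectorSpan ℝ (s : Set (Rd d)) := by
  rw [← direction_affineSpan]
  exact AffineSubspace.vsub_mem_direction (hull_subset_affineSpan s hx) (hull_subset_affineSpan s hy)

theorem mem_affineSpan_of_sub_mem {s : Finset (Rd d)} {x y : Rd d} (hy : y ∈ hull s)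
    (h : x - y ∈ vectorSpan ℝ (s : Set (Rd d))) : x ∈ affineSpan ℝ (s : Set (Rd d)) := by
  rw [← direction_affineSpan] at h
  simpa using AffineSubspace.vadd_mem_of_mem_direction h (hull_subset_affineSpan s hy)

theorem barycenter_mem_hull {s : Finset (Rd d)} (hs : s.Nonempty) : barycenter s ∈ hull s := by
  rw [barycenter, Finset.smul_sum]
  refine (convex_hull s).sum_mem (fun _ _ => by positivity) ?_
    fun x hx => subset_convexHull ℝ _ hx
  have : (s.card : ℝ) ≠ 0 := by exact_mod_cast hs.card_pos.ne'
  simp [this]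

theorem volume_affineSpan_eq_zero {s : Finset (Rd d)} (hs : s.card ≤ d) :
    volume (affineSpan ℝ (s : Set (Rd d)) : Set (Rd d)) = 0 := by
  refine Measure.addHaar_affineSubspace _ _ fun h => ?_
  obtain ⟨n, hn⟩ : ∃ n, s.card = n + 1 := by
    refine Nat.exists_eq_succ_of_ne_zero fun h0 => ?_
    rw [Finset.card_eq_zero] at h0
    subst h0
    simp at h
  have h1 := finrank_vectorSpan_range_le ℝ ((↑) : s → Rd d) (n := n) (by simpa using hn)
  rw [Subtype.range_coe_subtype] at h1
  change Module.finrank ℝ (vectorSpan ℝ (s : Set (Rd d))) ≤ n at h1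
  rw [← direction_affineSpan, h, AffineSubspace.direction_top, finrank_top,
    finrank_euclideanSpace_fin] at h1
  lia

theorem volume_hull_eq_zero {s : Finset (Rd d)} (hs : s.card ≤ d) : volume (hull s) = 0 :=
  measure_mono_null (hull_subset_affineSpan s) (volume_affineSpan_eq_zero hs)

theorem exists_eq_insert_of_facet [DecidableEq (Rd d)] {K e : Finset (Rd d)} (he : e ⊆ K)
    (hK : K.card = d + 1) (hec : e.card = d) : ∃ a, a ∉ e ∧ K = insert a e := by
  obtain ⟨a, ha, h⟩ := Finset.exists_eq_insert_iff.2 ⟨he, by rw [hec, hK]⟩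
  exact ⟨a, ha, h.symm⟩

theorem notMem_affineSpan_of_insert [DecidableEq (Rd d)] {e : Finset (Rd d)} {a : Rd d} (ha : a ∉ e)
    (h : AffineIndependent ℝ (Subtype.val : {x // x ∈ insert a e} → Rd d)) :
    a ∉ affineSpan ℝ (e : Set (Rd d)) := by
  intro hmem
  refine h.notMem_affineSpan_sdiff ⟨a, Finset.mem_insert_self a e⟩ Set.univ
    (affineSpan_mono ℝ ?_ hmem)
  intro x hx
  refine ⟨⟨x, Finset.mem_insert_of_mem hx⟩, ⟨Set.mem_univ _, ?_⟩, rfl⟩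
  rintro h
  obtain rfl : x = a := congrArg Subtype.val h
  exact ha hx

theorem mem_hull_insert [DecidableEq (Rd d)] {e : Finset (Rd d)} {a x : Rd d} (he : e.Nonempty)
    (hx : x ∈ hull (insert a e)) :
    ∃ (t : ℝ) (w : Rd d), 0 ≤ t ∧ t ≤ 1 ∧ w ∈ hull e ∧ x = a + t • (w - a) := by
  rw [hull, Finset.coe_insert, convexHull_insert (by simpa using he), mem_convexJoin] at hx
  obtain ⟨b, hb, w, hw, hx⟩ := hx
  rw [Set.mem_singleton_iff] at hb
  subst hb
  rw [segment_eq_image'] at hx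
  obtain ⟨t, ht, rfl⟩ := hx
  exact ⟨t, w, ht.1, ht.2, hw, rfl⟩

theorem add_smul_mem_hull_insert [DecidableEq (Rd d)] {e : Finset (Rd d)} {a w : Rd d} {t : ℝ}
    (hw : w ∈ hull e) (h0 : 0 ≤ t) (h1 : t ≤ 1) : w + t • (a - w) ∈ hull (insert a e) :=
  (convex_hull _).add_smul_sub_mem (hull_mono (Finset.subset_insert _ _) hw)
    (subset_convexHull ℝ _ (by simp)) ⟨h0, h1⟩

/-- A facet of a simplex contains a disk whose radius is that of a ball inscribed in the simplex. -/
theorem exists_disk_subset_facet {K e : Finset (Rd d)} (hi : AffineIndependent ℝ ((↑) : K → Rd d))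
    (hK : K.card = d + 1) (he : e ⊆ K) (hec : e.card = d) (hd : 1 ≤ d) {x : Rd d} {r : ℝ}
    (hr : 0 < r) (hx : closedBall x r ⊆ hull K) :
    ∃ y ∈ hull e, ∀ u ∈ vectorSpan ℝ (e : Set (Rd d)), ‖u‖ ≤ r → y + u ∈ hull e := by
  classical
  obtain ⟨a, ha, rfl⟩ := exists_eq_insert_of_facet he hK hec
  have hane := notMem_affineSpan_of_insert ha hi
  have hen : e.Nonempty := Finset.card_pos.1 (by lia)
  obtain ⟨t, w, ht0, ht1, hw, hxw⟩ := mem_hull_insert hen (hx (mem_closedBall_self hr.le))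
  refine ⟨w, hw, fun u hu hur => ?_⟩
  -- Project from the apex `a`. Since `u` is parallel to the facet and `a` is off its affine span,
  -- `x` and `x + u` have the same parameter `t`, so their projections `w` and `w'` satisfy `t • (w'
  -- - w) = u`.
  have key : ∀ u ∈ vectorSpan ℝ (e : Set (Rd d)), ‖u‖ ≤ r → ∃ w' ∈ hull e, t • (w' - w) = u := by
    intro u hu hur
    obtain ⟨t', w', -, -, hw', hxw'⟩ := mem_hull_insert hen (hx (show x + u ∈ closedBall x r by
      simpa [mem_closedBall] using hur))
    have h1 : (t' - t) • (a - w) = t' • (w' - w) - u := by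
      rw [hxw] at hxw'
      have : u = (a + t' • (w' - a)) - (a + t • (w - a)) := by rw [← hxw']; abel
      rw [this]
      module
    have htt : t' = t := by
      by_contra hne
      refine hane (mem_affineSpan_of_sub_mem hw ?_)
      have h2 : a - w = (t' - t)⁻¹ • (t' • (w' - w) - u) := by
        rw [← h1, inv_smul_smul₀ (sub_ne_zero.2 hne)]
      rw [h2]
      exact Submodule.smul_mem _ _ (Submodule.sub_mem _ (Submodule.smul_mem _ _
        (sub_mem_vectorSpan_of_mem_hull hw' hw)) hu)
    refine ⟨w', hw', ?_⟩
    rw [htt, sub_self, zero_smul] at h1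
    exact (sub_eq_zero.1 h1.symm)
  -- For `t = 0` the point `x` is the apex and `u` is forced to vanish. Otherwise the projection
  -- magnifies by `1 / t ≥ 1`, so `key` is applied to `t • u`, still of norm at most `r`.
  rcases eq_or_ne t 0 with h0 | h0
  · obtain ⟨w', -, h⟩ := key u hu hur
    rw [h0, zero_smul] at h
    rwa [← h, add_zero]
  · obtain ⟨w', hw', h⟩ := key (t • u) (Submodule.smul_mem _ _ hu) (by
      rw [norm_smul, Real.norm_eq_abs, abs_of_nonneg ht0]
      nlinarith [norm_nonneg u])
    have h2 : w' - w = u := smul_right_injective _ h0 h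
    rwa [← h2, add_sub_cancel]

theorem finrank_vectorSpan_facet {K e : Finset (Rd d)} (hi : AffineIndependent ℝ ((↑) : K → Rd d))
    (he : e ⊆ K) (hec : e.card = d) (hd : 1 ≤ d) :
    Module.finrank ℝ (vectorSpan ℝ (e : Set (Rd d))) = d - 1 := by
  have h : AffineIndependent ℝ ((↑) : e → Rd d) := hi.mono (Finset.coe_subset.2 he)
  have h1 := h.finrank_vectorSpan (n := d - 1) (by simp; lia)
  rw [Subtype.range_coe_subtype] at h1
  exact h1

/-- The volume of the unit ball of `ℝ^n`. -/
def unitBallVolume (n : ℕ) : ℝ := volume.real (closedBall (0 : Rd n) 1)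

theorem unitBallVolume_pos (n : ℕ) : 0 < unitBallVolume n :=
  ENNReal.toReal_pos (measure_closedBall_pos _ _ one_pos).ne' measure_closedBall_lt_top.ne

theorem volume_real_closedBall (n : ℕ) (x : Rd n) {r : ℝ} (hr : 0 ≤ r) :
    volume.real (closedBall x r) = r ^ n * unitBallVolume n := by
  rw [Measure.addHaar_real_closedBall' _ _ hr, finrank_euclideanSpace_fin, unitBallVolume]

/-- The affine hull of the facet is an isometric copy of `ℝ^(d-1)`, where the normalized Hausdorff
measure is Lebesgue measure; the facet lies between the images of two balls. -/
theorem measure_facet_bounds {K e : Finset (Rd d)} (hi : AffineIndependent ℝ ((↑) : K → Rd d))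
    (he : e ⊆ K) (hec : e.card = d) (hd : 1 ≤ d) {y : Rd d} {r R : ℝ} (hr : 0 ≤ r) (hR : 0 ≤ R)
    (hy : y ∈ hull e)
    (hyr : ∀ u ∈ vectorSpan ℝ (e : Set (Rd d)), ‖u‖ ≤ r → y + u ∈ hull e)
    (hyR : hull e ⊆ closedBall y R) :
    μHE[d - 1] (hull e) < ⊤ ∧
      r ^ (d - 1) * unitBallVolume (d - 1) ≤ μHE[d - 1].real (hull e) ∧
      μHE[d - 1].real (hull e) ≤ R ^ (d - 1) * unitBallVolume (d - 1) := by
  let L : Rd (d - 1) ≃ₗᵢ[ℝ] vectorSpan ℝ (e : Set (Rd d)) :=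
    (((stdOrthonormalBasis ℝ (vectorSpan ℝ (e : Set (Rd d)))).reindex
      (finCongr (finrank_vectorSpan_facet hi he hec hd))).repr).symm
  let f : Rd (d - 1) → Rd d := fun u => y + L u
  have hf : Isometry f :=
    (isometry_add_left y).comp ((vectorSpan ℝ (e : Set (Rd d))).subtypeₗᵢ.isometry.comp L.isometry)
  have hvol : ∀ s : Set (Rd (d - 1)), μHE[d - 1] (f '' s) = volume s := fun s => by
    rw [hf.euclideanHausdorffMeasure_image, EuclideanSpace.euclideanHausdorffMeasure_eq_volume]
  have h1 : f '' closedBall 0 r ⊆ hull e := by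
    rintro _ ⟨u, hu, rfl⟩
    refine hyr _ (L u).2 ?_
    rw [← Submodule.coe_norm, LinearIsometryEquiv.norm_map]
    simpa using hu
  have h2 : hull e ⊆ f '' closedBall 0 R := by
    intro x hx
    refine ⟨L.symm ⟨x - y, sub_mem_vectorSpan_of_mem_hull hx hy⟩, ?_, by simp [f]⟩
    rw [mem_closedBall_zero_iff, LinearIsometryEquiv.norm_map, Submodule.coe_norm, ← dist_eq_norm]
    exact hyR hx
  have h3 : μHE[d - 1] (f '' closedBall 0 R) < ⊤ := by
    rw [hvol]; exact measure_closedBall_lt_top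
  have h4 : μHE[d - 1] (hull e) < ⊤ := (measure_mono h2).trans_lt h3
  refine ⟨h4, ?_, ?_⟩
  · rw [← volume_real_closedBall (d - 1) 0 hr, measureReal_def, ← hvol, ← measureReal_def]
    exact measureReal_mono h1 h4.ne
  · rw [← volume_real_closedBall (d - 1) 0 hR, measureReal_def _ (closedBall _ _), ← hvol,
      ← measureReal_def]
    exact measureReal_mono h2 h3.ne

/-- The scaled measure of a facet of a shape regular simplex. -/
theorem scaled_measure_facet_bounds {K e : Finset (Rd d)}
    (hi : AffineIndependent ℝ ((↑) : K → Rd d)) (hK : K.card = d + 1) (he : e ⊆ K)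
    (hec : e.card = d) (hd : 2 ≤ d) {x : Rd d} {c h : ℝ} (hc : 0 < c) (hh : 0 < h)
    (hx : closedBall x (c * h) ⊆ hull K) (hKh : hdiam K ≤ h) :
    μHE[d - 1] (hull e) < ⊤ ∧
      c ^ (d - 1) * unitBallVolume (d - 1) * h ^ (d - 2) ≤
        (hdiam e)⁻¹ * μHE[d - 1].real (hull e) ∧
      (hdiam e)⁻¹ * μHE[d - 1].real (hull e) ≤ c⁻¹ * unitBallVolume (d - 1) * h ^ (d - 2) := by
  have hch : 0 < c * h := by positivity
  obtain ⟨y, hy, hyr⟩ := exists_disk_subset_facet hi hK he hec (by lia) hch hx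
  have hb : Bornology.IsBounded (hull e) := (isCompact_hull e).isBounded
  have heK : hdiam e ≤ h := (diam_mono (hull_mono he) (isCompact_hull K).isBounded).trans hKh
  have hyR : hull e ⊆ closedBall y h := fun z hz =>
    mem_closedBall.2 ((dist_le_diam_of_mem hb hz hy).trans heK)
  obtain ⟨h1, h2, h3⟩ := measure_facet_bounds hi he hec (by lia) hch.le hh.le hy hyr hyR
  -- As `d ≥ 2`, the facet has a direction of positive length, and the disk contains a vector of
  -- length `c * h` in it.
  have hr : c * h ≤ hdiam e := by
    have : Nontrivial (vectorSpan ℝ (e : Set (Rd d))) :=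
      Module.nontrivial_of_finrank_pos (R := ℝ) (by
        rw [finrank_vectorSpan_facet hi he hec (by lia)]; lia)
    obtain ⟨u, hu⟩ := exists_norm_eq (vectorSpan ℝ (e : Set (Rd d))) hch.le
    have h4 := dist_le_diam_of_mem hb (hyr u u.2 hu.le) hy
    rwa [dist_self_add_left, Submodule.norm_coe, hu] at h4
  have hω := unitBallVolume_pos (d - 1)
  have hpos : 0 < hdiam e := hch.trans_le hr
  refine ⟨h1, ?_, ?_⟩
  · calc c ^ (d - 1) * unitBallVolume (d - 1) * h ^ (d - 2)
        = h⁻¹ * ((c * h) ^ (d - 1) * unitBallVolume (d - 1)) := by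
          obtain ⟨k, rfl⟩ := Nat.exists_eq_add_of_le' hd
          rw [Nat.add_sub_cancel, show k + 2 - 1 = k + 1 by lia]
          field_simp
          ring
      _ ≤ _ := by gcongr
  · calc (hdiam e)⁻¹ * μHE[d - 1].real (hull e)
        ≤ (c * h)⁻¹ * (h ^ (d - 1) * unitBallVolume (d - 1)) := by gcongr
      _ = _ := by
          obtain ⟨k, rfl⟩ := Nat.exists_eq_add_of_le' hd
          rw [Nat.add_sub_cancel, show k + 2 - 1 = k + 1 by lia]
          field_simp
          ring

/-- The factor is positive, so normalizing with the apex in place of the barycenter of the simplex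
gives the same unit normal. -/
theorem barycenter_sub_barycenter_insert [DecidableEq (Rd d)] {e : Finset (Rd d)} {a : Rd d}
    (ha : a ∉ e) (he : e.Nonempty) :
    barycenter e - barycenter (insert a e) = ((e.card : ℝ) + 1)⁻¹ • (barycenter e - a) := by
  have h0 : (e.card : ℝ) ≠ 0 := by exact_mod_cast he.card_pos.ne'
  have h1 : (e.card : ℝ) + 1 ≠ 0 := by positivity
  rw [barycenter, barycenter, Finset.card_insert_of_notMem ha, Finset.sum_insert ha]
  push_cast
  match_scalars <;> field_simp
  ring

/-- The unit normal is determined by the component orthogonal to the facet of the vector from the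
opposite vertex to any point of the facet. -/
theorem outwardNormal_insert [DecidableEq (Rd d)] {e : Finset (Rd d)} {a y : Rd d} (ha : a ∉ e)
    (hy : y ∈ hull e) :
    outwardNormal (insert a e) e =
      ‖(vectorSpan ℝ (e : Set (Rd d)))ᗮ.starProjection (y - a)‖⁻¹ •
        (vectorSpan ℝ (e : Set (Rd d)))ᗮ.starProjection (y - a) := by
  have he : e.Nonempty := by
    rw [Finset.nonempty_iff_ne_empty]
    rintro rfl
    simp [hull] at hy
  have h1 : (vectorSpan ℝ (e : Set (Rd d)))ᗮ.starProjection (barycenter e - y) = 0 := by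
    rw [Submodule.starProjection_apply_eq_zero_iff, Submodule.orthogonal_orthogonal]
    exact sub_mem_vectorSpan_of_mem_hull (barycenter_mem_hull he) hy
  have h2 : (vectorSpan ℝ (e : Set (Rd d)))ᗮ.starProjection (barycenter e - a) =
      (vectorSpan ℝ (e : Set (Rd d)))ᗮ.starProjection (y - a) := by
    rw [← sub_add_sub_cancel _ y, map_add, h1, zero_add]
  have h3 : 0 < ((e.card : ℝ) + 1)⁻¹ := by positivity
  rw [outwardNormal, barycenter_sub_barycenter_insert ha he, map_smul, h2, norm_smul,
    Real.norm_eq_abs, abs_of_pos h3, mul_inv, smul_smul, mul_right_comm, inv_mul_cancel₀ h3.ne',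
    one_mul]

theorem starProjection_facet_ne_zero {e : Finset (Rd d)} {a y : Rd d} (hy : y ∈ hull e)
    (ha : a ∉ affineSpan ℝ (e : Set (Rd d))) :
    (vectorSpan ℝ (e : Set (Rd d)))ᗮ.starProjection (y - a) ≠ 0 := by
  rw [Ne, Submodule.starProjection_apply_eq_zero_iff, Submodule.orthogonal_orthogonal]
  intro h
  refine ha (mem_affineSpan_of_sub_mem hy ?_)
  rw [← neg_sub]
  exact Submodule.neg_mem _ h

theorem norm_outwardNormal {K e : Finset (Rd d)} (hi : AffineIndependent ℝ ((↑) : K → Rd d))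
    (hK : K.card = d + 1) (he : e ⊆ K) (hec : e.card = d) (hd : 1 ≤ d) :
    ‖outwardNormal K e‖ = 1 := by
  classical
  obtain ⟨a, ha, rfl⟩ := exists_eq_insert_of_facet he hK hec
  have hy := barycenter_mem_hull (s := e) (Finset.card_pos.1 (by lia))
  rw [outwardNormal_insert ha hy, norm_smul, norm_inv, norm_norm, inv_mul_cancel₀]
  exact norm_ne_zero_iff.2 (starProjection_facet_ne_zero hy (notMem_affineSpan_of_insert ha hi))

/-- Two simplices on the same side of a common facet overlap outside the facet. -/
theorem coef_nonpos_of_inter_subset [DecidableEq (Rd d)] {e : Finset (Rd d)} {a a' y u : Rd d}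
    {t r : ℝ} (hy : y ∈ hull e) (ha' : a' ∉ affineSpan ℝ (e : Set (Rd d))) (hr : 0 < r)
    (hyr : ∀ u ∈ vectorSpan ℝ (e : Set (Rd d)), ‖u‖ ≤ r → y + u ∈ hull e)
    (hint : hull (insert a e) ∩ hull (insert a' e) ⊆ hull e)
    (hu : u ∈ vectorSpan ℝ (e : Set (Rd d))) (h : y - a' = t • (y - a) + u) : t ≤ 0 := by
  by_contra! ht
  -- Move from `y` by `ε` towards `a'`. For `t > 0` this point also lies on the segment from a facet
  -- point `w` towards `a`. Here `ε ≤ 1` keeps it in the second simplex, `ε * t ≤ 1 / 2` in the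
  -- first, and together with `ε * ‖u‖ ≤ r / 2` this keeps `w` in the disk around `y`.
  obtain ⟨ε, hε0, hε1, hεt, hεu⟩ : ∃ ε : ℝ, 0 < ε ∧ ε ≤ 1 ∧ ε * t ≤ 1 / 2 ∧ ε * ‖u‖ ≤ r / 2 := by
    refine ⟨min 1 (min (1 / 2 / t) (r / 2 / (‖u‖ + 1))), by positivity, min_le_left _ _, ?_, ?_⟩
    · rw [← le_div_iff₀ ht]
      exact (min_le_right _ _).trans (min_le_left _ _)
    · have h1 : min 1 (min (1 / 2 / t) (r / 2 / (‖u‖ + 1))) ≤ r / 2 / (‖u‖ + 1) :=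
        (min_le_right _ _).trans (min_le_right _ _)
      calc _ ≤ r / 2 / (‖u‖ + 1) * (‖u‖ + 1) := by gcongr; linarith
        _ = r / 2 := by field_simp
  have h1 : (0 : ℝ) < 1 - ε * t := by linarith
  set w := y + (-(ε / (1 - ε * t))) • u with hw
  have hwe : w ∈ hull e := by
    refine hyr _ (Submodule.smul_mem _ _ hu) ?_
    rw [norm_smul, norm_neg, Real.norm_eq_abs, abs_of_pos (by positivity), div_mul_eq_mul_div,
      div_le_iff₀ h1]
    nlinarith
  have h2 : y + ε • (a' - y) ∈ hull (insert a' e) := add_smul_mem_hull_insert hy hε0.le hε1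
  have h3 : y + ε • (a' - y) = w + (ε * t) • (a - w) := by
    have h4 : a' - y = t • (a - y) - u := by
      rw [← neg_sub y a', h]
      module
    rw [h4, hw]
    match_scalars <;> field_simp
    ring
  -- The common point must lie in the facet, so `a' - y` is parallel to the facet, against the
  -- choice of `a'`.
  have h5 := hint ⟨h3 ▸ add_smul_mem_hull_insert hwe (by positivity) (by linarith), h2⟩
  have h6 := sub_mem_vectorSpan_of_mem_hull h5 hy
  rw [add_sub_cancel_left] at h6
  have h7 := Submodule.smul_mem _ ε⁻¹ h6
  rw [inv_smul_smul₀ hε0.ne'] at h7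
  exact ha' (mem_affineSpan_of_sub_mem hy h7)

/-- The normals of two different simplices on a common facet are opposite. -/
theorem outwardNormal_eq_neg {K K' e : Finset (Rd d)}
    (hi : AffineIndependent ℝ ((↑) : K → Rd d)) (hi' : AffineIndependent ℝ ((↑) : K' → Rd d))
    (hK : K.card = d + 1) (hK' : K'.card = d + 1) (he : e ⊆ K) (he' : e ⊆ K') (hec : e.card = d)
    (hd : 1 ≤ d) {x : Rd d} {r : ℝ} (hr : 0 < r) (hx : closedBall x r ⊆ hull K)
    (hint : hull K ∩ hull K' ⊆ hull e) : outwardNormal K' e = -outwardNormal K e := by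
  classical
  obtain ⟨y, hy, hyr⟩ := exists_disk_subset_facet hi hK he hec hd hr hx
  obtain ⟨a, ha, rfl⟩ := exists_eq_insert_of_facet he hK hec
  obtain ⟨a', ha', rfl⟩ := exists_eq_insert_of_facet he' hK' hec
  have hs := notMem_affineSpan_of_insert ha hi
  have hs' := notMem_affineSpan_of_insert ha' hi'
  have hp := starProjection_facet_ne_zero hy hs
  have hp' := starProjection_facet_ne_zero hy hs'
  rw [outwardNormal_insert ha hy, outwardNormal_insert ha' hy]
  set F := vectorSpan ℝ (e : Set (Rd d)) with hF
  -- The orthogonal complement is a line, so the two projected vectors are proportional. The ratio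
  -- `t` is nonpositive because the simplices do not overlap, and nonzero because both projections
  -- are.
  have hrank : Module.finrank ℝ Fᗮ = 1 := by
    have h1 := Submodule.finrank_add_finrank_orthogonal F
    rw [finrank_euclideanSpace_fin, finrank_vectorSpan_facet hi he hec hd] at h1
    exact Nat.add_left_cancel (h1.trans (Nat.sub_add_cancel hd).symm)
  obtain ⟨t, ht⟩ := (finrank_eq_one_iff_of_nonzero'
    (⟨_, Fᗮ.starProjection_apply_mem (y - a)⟩ : Fᗮ) (by simpa using hp)).1 hrank
      ⟨_, Fᗮ.starProjection_apply_mem (y - a')⟩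
  have ht' : Fᗮ.starProjection (y - a') = t • Fᗮ.starProjection (y - a) :=
    (congrArg Subtype.val ht).symm
  have h0 : (y - a') - t • (y - a) ∈ F := by
    rw [← Submodule.orthogonal_orthogonal F, ← Submodule.starProjection_apply_eq_zero_iff, map_sub,
      map_smul, ht', sub_self]
  have htn := coef_nonpos_of_inter_subset hy hs' hr hyr hint h0 (t := t) (by abel)
  have ht0 : t ≠ 0 := by
    rintro rfl
    exact hp' (by rw [ht', zero_smul])
  rw [ht', norm_smul, Real.norm_eq_abs, abs_of_nonpos htn, smul_smul, ← neg_smul]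
  congr 1
  field_simp

end

/-! ### Shape-regular triangulations: covering, counting and jumps -/

section

namespace Triangulation

variable {d : ℕ} {Ω : Set (Rd d)} {T : Triangulation Ω}

theorem Elem.mem_faces (K : T.Elem) : K.1 ∈ T.faces := by
  have := (Finset.mem_filter.1 K.2).1
  simpa using this

theorem Elem.card_eq (K : T.Elem) : K.1.card = d + 1 := (Finset.mem_filter.1 K.2).2

theorem Elem.indep (K : T.Elem) : AffineIndependent ℝ ((↑) : K.1 → Rd d) := T.indep K.mem_faces

theorem Elem.nonempty (K : T.Elem) : K.1.Nonempty := Finset.card_pos.1 (by rw [K.card_eq]; lia)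

theorem card_of_mem_facets {e : Finset (Rd d)} (he : e ∈ T.facets) : e.card = d :=
  (Finset.mem_filter.1 he).2

/-- The elements of a triangulation cover the domain: the lower-dimensional simplices are null
sets. -/
theorem exists_elem_mem_hull (T : Triangulation Ω) (hΩ : IsOpen Ω) {x : Rd d} (hx : x ∈ closure Ω) :
    ∃ K : T.Elem, x ∈ hull K.1 := by
  set A : Set (Rd d) := ⋃ K : T.Elem, hull K.1 with hA
  have hAc : IsClosed A := isClosed_iUnion_of_finite fun K => (isCompact_hull K.1).isClosed
  set B : Set (Rd d) := ⋃ s ∈ {s | s ∈ T.faces ∧ s.card ≤ d}, hull s with hB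
  have hB0 : volume B = 0 :=
    (measure_biUnion_null_iff (T.finite_faces.subset fun s hs => hs.1).countable).2
      fun s hs => volume_hull_eq_zero hs.2
  -- Affine independence allows at most `d + 1` vertices, so a face that is not an element is null.
  -- Thus `Ω \ A` is open and null, hence empty, and closedness of `A` extends the covering to
  -- `closure Ω`.
  have hsub : Ω \ A ⊆ B := by
    rintro y ⟨hy, hyA⟩
    have h1 := subset_closure hy
    rw [← T.space_eq, Set.mem_iUnion₂] at h1
    obtain ⟨s, hs, hys⟩ := h1
    refine Set.mem_biUnion (x := s) ⟨hs, ?_⟩ hys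
    by_contra! hcard
    have h2 := (T.indep hs).card_le_finrank_succ
    have h3 := Submodule.finrank_le (vectorSpan ℝ (Set.range ((↑) : s → Rd d)))
    rw [finrank_euclideanSpace_fin] at h3
    rw [Fintype.card_coe] at h2
    refine hyA (Set.mem_iUnion.2 ⟨⟨s, Finset.mem_filter.2 ⟨by simpa using hs, ?_⟩⟩, hys⟩)
    exact le_antisymm (h2.trans (Nat.succ_le_succ h3)) hcard
  have hempty : Ω \ A = ∅ :=
    (hΩ.sdiff hAc).eq_empty_of_measure_zero (measure_mono_null hsub hB0)
  exact Set.mem_iUnion.1 (hAc.closure_subset_iff.2 (Set.sdiff_eq_empty.1 hempty) hx)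

theorem nonempty_elem (T : Triangulation Ω) (hΩ : IsConvexPolytopalDomain Ω) : Nonempty T.Elem := by
  obtain ⟨⟨x, hx⟩, V, rfl⟩ := hΩ
  exact ⟨(T.exists_elem_mem_hull isOpen_interior (subset_closure hx)).choose⟩

/-- Two different elements meet in a common face of lower dimension. -/
theorem exists_inter_hull_subset {K K' : T.Elem} (h : K ≠ K') :
    ∃ e : Finset (Rd d), e.card ≤ d ∧ e ⊆ K.1 ∧ e ⊆ K'.1 ∧ hull K.1 ∩ hull K'.1 ⊆ hull e ∧
      ∀ e', e' ⊆ K.1 → e' ⊆ K'.1 → e' ⊆ e := by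
  classical
  refine ⟨K.1 ∩ K'.1, ?_, Finset.inter_subset_left, Finset.inter_subset_right, ?_,
    fun e' => Finset.subset_inter⟩
  · by_contra! hc
    have h1 : K.1 ∩ K'.1 = K.1 :=
      Finset.eq_of_subset_of_card_le Finset.inter_subset_left (by rw [K.card_eq]; exact hc)
    have h2 : K.1 ∩ K'.1 = K'.1 :=
      Finset.eq_of_subset_of_card_le Finset.inter_subset_right (by rw [K'.card_eq]; exact hc)
    exact h (Subtype.ext (h1.symm.trans h2))
  · have := T.inter_subset_convexHull K.mem_faces K'.mem_faces
    rwa [← Finset.coe_inter] at this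

/-- Shape regularity and quasi-uniformity with explicit constants. -/
structure IsRegular (T : Triangulation Ω) (c h : ℝ) : Prop where
  pos_const : 0 < c
  pos : 0 < h
  diam_le : ∀ K : T.Elem, hdiam K.1 ≤ h
  exists_ball : ∀ K : T.Elem, ∃ x, closedBall x (c * h) ⊆ hull K.1

theorem hdiam_pos (hd : 1 ≤ d) (K : T.Elem) : 0 < hdiam K.1 := by
  have h1 : 1 < K.1.card := by rw [K.card_eq]; lia
  obtain ⟨a, ha, b, hb, hab⟩ := Finset.one_lt_card.1 h1
  exact (dist_pos.2 hab).trans_le (dist_le_diam_of_mem (isCompact_hull K.1).isBounded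
    (subset_convexHull ℝ _ ha) (subset_convexHull ℝ _ hb))

/-- The inradius is defined as a supremum. The factor 2 in the constant makes `c * h` strictly
smaller than it, so that an actual inscribed ball can be extracted. -/
theorem exists_isRegular (hd : 1 ≤ d) [Nonempty T.Elem] {Cσ : ℝ} (hC : 0 < Cσ)
    (h : T.meshSize ≤ Cσ * T.minInradius) : ∃ h, T.IsRegular (2 * Cσ)⁻¹ h := by
  have hle : ∀ K : T.Elem, hdiam K.1 ≤ T.meshSize := fun K =>
    le_ciSup (f := fun K : T.Elem => hdiam K.1) (Set.finite_range _).bddAbove K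
  have hpos : 0 < T.meshSize := (hdiam_pos hd (Classical.arbitrary T.Elem)).trans_le (hle _)
  refine ⟨T.meshSize, by positivity, hpos, hle, fun K => ?_⟩
  have h1 : T.minInradius ≤ inradius K.1 :=
    ciInf_le (f := fun K : T.Elem => inradius K.1) (Set.finite_range _).bddBelow K
  have h2 : (2 * Cσ)⁻¹ * T.meshSize < inradius K.1 := by
    rw [inv_mul_lt_iff₀ (by positivity)]
    have : 0 < Cσ * T.minInradius := hpos.trans_le h
    nlinarith
  -- An empty set of radii would have supremum 0 by convention, which contradicts `h2`.
  obtain ⟨r, ⟨-, x, hx⟩, hr⟩ := exists_lt_of_lt_csSup (s := {r : ℝ | 0 ≤ r ∧ ∃ x : Rd d,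
    closedBall x r ⊆ hull K.1}) (by
      by_contra h0
      rw [Set.not_nonempty_iff_eq_empty] at h0
      rw [inradius, h0, Real.sSup_empty] at h2
      exact absurd h2 (not_lt.2 (by positivity))) h2
  exact ⟨x, (closedBall_subset_closedBall hr.le).trans hx⟩

namespace IsRegular

variable {c h : ℝ}

theorem volume_hull_ne_zero (hT : T.IsRegular c h) (K : T.Elem) : volume (hull K.1) ≠ 0 := by
  obtain ⟨x, hx⟩ := hT.exists_ball K
  have := hT.pos
  have := hT.pos_const
  exact ((measure_closedBall_pos volume x (by positivity)).trans_le (measure_mono hx)).ne'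

theorem dist_le (hT : T.IsRegular c h) (K : T.Elem) {x y : Rd d} (hx : x ∈ hull K.1)
    (hy : y ∈ hull K.1) : dist x y ≤ h :=
  (dist_le_diam_of_mem (isCompact_hull K.1).isBounded hx hy).trans (hT.diam_le K)

theorem barycenter_mem (K : T.Elem) : barycenter K.1 ∈ hull K.1 := barycenter_mem_hull K.nonempty

/-- The number of elements in a ball of radius comparable with the mesh size is bounded. -/
theorem card_le (hT : T.IsRegular c h) (S : Finset T.Elem) (a : Rd d) {D : ℝ} (hD : 0 ≤ D)
    (hS : ∀ K ∈ S, hull K.1 ⊆ closedBall a (D * h)) : (S.card : ℝ) ≤ (D / c) ^ d := by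
  have hc := hT.pos_const
  have hh := hT.pos
  -- Two elements overlap in a null set, so volumes add; each is at least that of a ball of radius
  -- `c * h`.
  have h1 : volume.real (⋃ K ∈ S, hull K.1) = ∑ K ∈ S, volume.real (hull K.1) := by
    refine measureReal_biUnion_finset₀ ?_ ?_ ?_
    · intro K _ K' _ hne
      obtain ⟨e, hec, -, -, he, -⟩ := exists_inter_hull_subset hne
      exact measure_mono_null he (volume_hull_eq_zero hec)
    · exact fun K _ => (isCompact_hull K.1).isClosed.measurableSet.nullMeasurableSet
    · exact fun K _ => (isCompact_hull K.1).measure_lt_top.ne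
  have h2 : volume.real (⋃ K ∈ S, hull K.1) ≤ volume.real (closedBall a (D * h)) :=
    measureReal_mono (Set.iUnion₂_subset hS) measure_closedBall_lt_top.ne
  have h3 : ∀ K ∈ S, (c * h) ^ d * unitBallVolume d ≤ volume.real (hull K.1) := by
    intro K _
    obtain ⟨x, hx⟩ := hT.exists_ball K
    rw [← volume_real_closedBall d x (by positivity)]
    exact measureReal_mono hx (isCompact_hull K.1).measure_lt_top.ne
  have h4 := Finset.card_nsmul_le_sum _ _ _ h3
  rw [← h1, nsmul_eq_mul] at h4
  have h5 := h4.trans h2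
  rw [volume_real_closedBall d a (by positivity), ← mul_assoc] at h5
  have h6 := le_of_mul_le_mul_right h5 (unitBallVolume_pos d)
  rw [div_pow, le_div_iff₀ (by positivity)]
  rw [mul_pow, mul_pow, ← mul_assoc] at h6
  exact le_of_mul_le_mul_right h6 (by positivity)

theorem norm_normal (hd : 1 ≤ d) {e : Finset (Rd d)} (he : e ∈ T.facets)
    (K : T.Elem) (heK : e ⊆ K.1) : ‖outwardNormal K.1 e‖ = 1 :=
  norm_outwardNormal K.indep K.card_eq heK (card_of_mem_facets he) hd

theorem normal_eq_neg (hT : T.IsRegular c h) (hd : 1 ≤ d) {e : Finset (Rd d)} (he : e ∈ T.facets)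
    {K K' : T.Elem} (hne : K ≠ K') (heK : e ⊆ K.1) (heK' : e ⊆ K'.1) :
    outwardNormal K'.1 e = -outwardNormal K.1 e := by
  obtain ⟨x, hx⟩ := hT.exists_ball K
  refine outwardNormal_eq_neg K.indep K'.indep K.card_eq K'.card_eq heK heK' (card_of_mem_facets he)
    hd (mul_pos hT.pos_const hT.pos) hx ?_
  obtain ⟨e', hec, -, -, he', hmax⟩ := exists_inter_hull_subset hne
  have h1 : e = e' := Finset.eq_of_subset_of_card_le (hmax e heK heK')
    (by rw [card_of_mem_facets he]; exact hec)
  rwa [h1]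

/-- A facet belongs to at most two elements. -/
theorem eq_or_eq (hT : T.IsRegular c h) (hd : 1 ≤ d) {e : Finset (Rd d)} (he : e ∈ T.facets)
    {K K' K'' : T.Elem} (hne : K ≠ K') (heK : e ⊆ K.1) (heK' : e ⊆ K'.1) (heK'' : e ⊆ K''.1) :
    K'' = K ∨ K'' = K' := by
  -- Three elements on one facet would have pairwise opposite normals, forcing a unit vector to
  -- equal its negative.
  by_contra! hcon
  have h1 := hT.normal_eq_neg hd he hne heK heK'
  have h2 := hT.normal_eq_neg hd he hcon.1 heK'' heK
  have h3 := hT.normal_eq_neg hd he hcon.2 heK'' heK'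
  have h4 : outwardNormal K.1 e = 0 := by
    rw [h3, ← h2] at h1
    have h5 : (2 : ℝ) • outwardNormal K.1 e = 0 := by
      rw [two_smul]
      nth_rewrite 1 [h1]
      exact neg_add_cancel _
    exact (smul_eq_zero.1 h5).resolve_left two_ne_zero
  have h5 := norm_normal hd he K heK
  rw [h4, norm_zero] at h5
  exact zero_ne_one h5

open Classical in
theorem card_filter_facet_le (hT : T.IsRegular c h) (hd : 1 ≤ d) {e : Finset (Rd d)}
    (he : e ∈ T.facets) : (Finset.univ.filter fun K : T.Elem => e ⊆ K.1).card ≤ 2 := by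
  by_contra! hcon
  obtain ⟨K, K', K'', h1, h2, h3, h12, h13, h23⟩ := Finset.two_lt_card_iff.1 hcon
  simp only [Finset.mem_filter, Finset.mem_univ, true_and] at h1 h2 h3
  rcases hT.eq_or_eq hd he h12 h1 h2 h3 with rfl | rfl
  · exact h13 rfl
  · exact h23 rfl

/-- The jump of a piecewise constant function across an interior facet. -/
theorem norm_jump_toBroken (hT : T.IsRegular c h) (hd : 1 ≤ d) {e : Finset (Rd d)}
    (he : e ∈ T.facets) {K K' : T.Elem} (hne : K ≠ K') (heK : e ⊆ K.1) (heK' : e ⊆ K'.1)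
    (v : T.PiecewiseConst) (x : Rd d) : ‖T.jump v.toBroken e x‖ = |v K - v K'| := by
  classical
  have h1 : (Finset.univ.filter fun K : T.Elem => e ⊆ K.1) = {K, K'} := by
    ext K''
    simp only [Finset.mem_filter, Finset.mem_univ, true_and, Finset.mem_insert,
      Finset.mem_singleton]
    refine ⟨hT.eq_or_eq hd he hne heK heK', ?_⟩
    rintro (rfl | rfl)
    exacts [heK, heK']
  have h2 : T.jump v.toBroken e x = (v K - v K') • outwardNormal K.1 e := by
    unfold jump
    convert! (Finset.sum_pair hne : ∑ K'' ∈ {K, K'}, v K'' • outwardNormal K''.1 e = _) using 1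
    · refine Finset.sum_congr ?_ fun _ _ => rfl
      convert h1
    · rw [hT.normal_eq_neg hd he hne heK heK']
      module
  rw [h2, norm_smul, norm_normal hd he K heK, mul_one, Real.norm_eq_abs]

end IsRegular

end Triangulation

end

/-! ### Discrete Poincaré estimate: chains of elements along generic segments -/

section

namespace Triangulation

variable {d : ℕ} {Ω : Set (Rd d)} {T : Triangulation Ω}

/-- Two elements which share a facet. -/
def facetGraph (T : Triangulation Ω) : SimpleGraph T.Elem where
  Adj K K' := K ≠ K' ∧ ∃ e ∈ T.facets, e ⊆ K.1 ∧ e ⊆ K'.1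
  symm := ⟨fun _ _ ⟨hne, e, he, h1, h2⟩ => ⟨hne.symm, e, he, h2, h1⟩⟩
  loopless := ⟨fun _ h => h.1 rfl⟩

/-- The elements which meet a set. -/
def meeting (T : Triangulation Ω) (s : Set (Rd d)) : Set T.Elem :=
  {K | (s ∩ hull K.1).Nonempty}

/-- A segment which avoids the `(d-2)`-skeleton passes from element to element through facets. -/
theorem reachable_of_segment {s : Set (Rd d)} (hs : IsPreconnected s)
    (hcover : ∀ x ∈ s, ∃ K : T.Elem, x ∈ hull K.1)
    (hskel : ∀ e ∈ T.faces, e.card < d → Disjoint s (hull e)) (K K' : T.meeting s) :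
    (T.facetGraph.induce (T.meeting s)).Reachable K K' := by
  by_contra hcon
  set G := T.facetGraph.induce (T.meeting s) with hG
  -- `A` and `B` are closed and cover the connected set `s`, so they share a point of `s`. That
  -- point lies in a reachable and an unreachable element, and in their common face. Since `s`
  -- avoids the smaller faces, this face is a facet, which links the two elements.
  set A : Set (Rd d) := ⋃ L ∈ {L : T.meeting s | G.Reachable K L}, hull L.1.1
  set B : Set (Rd d) := ⋃ L ∈ {L : T.meeting s | ¬ G.Reachable K L}, hull L.1.1
  have hA : IsClosed A :=
    (Set.toFinite _).isClosed_biUnion fun L _ => (isCompact_hull L.1.1).isClosed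
  have hB : IsClosed B :=
    (Set.toFinite _).isClosed_biUnion fun L _ => (isCompact_hull L.1.1).isClosed
  have hAB : s ⊆ A ∪ B := by
    intro x hx
    obtain ⟨L, hL⟩ := hcover x hx
    have hLs : L ∈ T.meeting s := ⟨x, hx, hL⟩
    by_cases h : G.Reachable K ⟨L, hLs⟩
    · exact Or.inl (Set.mem_biUnion (x := (⟨L, hLs⟩ : T.meeting s)) h hL)
    · exact Or.inr (Set.mem_biUnion (x := (⟨L, hLs⟩ : T.meeting s)) h hL)
  obtain ⟨x, hx, hxK⟩ := K.2
  obtain ⟨y, hy, hyK⟩ := K'.2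
  obtain ⟨z, hz, hzA, hzB⟩ := isPreconnected_closed_iff.1 hs A B hA hB hAB
    ⟨x, hx, Set.mem_biUnion (x := K) (SimpleGraph.Reachable.refl K) hxK⟩
    ⟨y, hy, Set.mem_biUnion (x := K') hcon hyK⟩
  obtain ⟨L, hL, hzL⟩ := Set.mem_iUnion₂.1 hzA
  obtain ⟨L', hL', hzL'⟩ := Set.mem_iUnion₂.1 hzB
  have hne : L.1 ≠ L'.1 := by
    intro h
    rw [Subtype.ext h] at hL
    exact hL' hL
  obtain ⟨e, hec, heL, heL', he, -⟩ := exists_inter_hull_subset hne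
  have hze := he ⟨hzL, hzL'⟩
  have hen : e.Nonempty := by
    rw [Finset.nonempty_iff_ne_empty]
    rintro rfl
    simp [hull] at hze
  have hef : e ∈ T.faces := T.down_closed L.1.mem_faces heL hen
  have hcard : e.card = d := by
    refine le_antisymm hec (not_lt.1 fun hlt => ?_)
    exact Set.disjoint_left.1 (hskel e hef hlt) hz hze
  refine hL' (hL.trans (SimpleGraph.Adj.reachable ?_))
  exact ⟨hne, e, Finset.mem_filter.2 ⟨by simpa using hef, hcard⟩, heL, heL'⟩

theorem abs_sub_le_length_mul {V : Type*} {G : SimpleGraph V} {f : V → ℝ} {S : ℝ}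
    (h : ∀ a b, G.Adj a b → |f a - f b| ≤ S) {a b : V} (p : G.Walk a b) :
    |f a - f b| ≤ p.length * S := by
  induction p with
  | nil => simp
  | @cons u v w hadj p ih =>
    rw [SimpleGraph.Walk.length_cons]
    push_cast
    have := abs_sub_le (f u) (f v) (f w)
    linarith [h u v hadj]

/-- A generic segment between two elements. -/
theorem IsRegular.exists_segment {c h : ℝ} (hT : T.IsRegular c h) (K K' : T.Elem) :
    ∃ x ∈ hull K.1, ∃ y ∈ hull K'.1,
      ∀ e ∈ T.faces, e.card < d → Disjoint (segment ℝ x y) (hull e) := by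
  classical
  have hex : ∀ (L : T.Elem) (f : Finset (Rd d) → Finset (Rd d)),
      (∀ e ∈ T.faces, e.card < d → (f e).card ≤ d) → ∃ x ∈ hull L.1, ∀ e ∈ T.faces, e.card < d →
        x ∉ affineSpan ℝ (f e : Set (Rd d)) := by
    intro L f hf
    set B : Set (Rd d) := ⋃ e ∈ {e | e ∈ T.faces ∧ e.card < d}, affineSpan ℝ (f e : Set (Rd d))
    have hB0 : volume B = 0 :=
      (measure_biUnion_null_iff (T.finite_faces.subset fun s hs => hs.1).countable).2
        fun e he => volume_affineSpan_eq_zero (hf e he.1 he.2)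
    obtain ⟨x, hx, hxB⟩ : (hull L.1 \ B).Nonempty := by
      rw [Set.nonempty_iff_ne_empty, Ne, Set.sdiff_eq_empty]
      intro hsub
      exact hT.volume_hull_ne_zero L (measure_mono_null hsub hB0)
    refine ⟨x, hx, fun e he hec hmem => hxB ?_⟩
    exact Set.mem_biUnion (x := e) ⟨he, hec⟩ hmem
  obtain ⟨x, hx, hxe⟩ := hex K id fun e _ he => he.le
  -- `x` avoids the spans of the skeleton faces and `y` those of the same faces with `x` added,
  -- which still have at most `d` points. If the segment met a face at a point other than `x`, then
  -- `y`, on the line through both, would lie in the enlarged span.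
  obtain ⟨y, hy, hye⟩ := hex K' (insert x) fun e _ he => (Finset.card_insert_le _ _).trans he
  refine ⟨x, hx, y, hy, fun e he hec => Set.disjoint_left.2 fun z hz hze => ?_⟩
  have hz1 := hull_subset_affineSpan e hze
  rw [segment_eq_image'] at hz
  obtain ⟨θ, -, rfl⟩ := hz
  rcases eq_or_ne θ 0 with rfl | hθ
  · exact hxe e he hec (by simpa using hz1)
  · refine hye e he hec ?_
    have hx1 : x ∈ affineSpan ℝ ((insert x e : Finset (Rd d)) : Set (Rd d)) :=
      subset_affineSpan ℝ _ (by simp)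
    have hz2 : x + θ • (y - x) ∈ affineSpan ℝ ((insert x e : Finset (Rd d)) : Set (Rd d)) :=
      affineSpan_mono ℝ (Finset.coe_subset.2 (Finset.subset_insert x e)) hz1
    have h1 := AffineMap.lineMap_mem θ⁻¹ hx1 hz2
    rw [AffineMap.lineMap_apply] at h1
    simpa [smul_smul, hθ] using h1

open Classical in
/-- The elements contained in the ball of radius `R` around the barycenter of `K`. -/
def near (T : Triangulation Ω) (R : ℝ) (K : T.Elem) : Finset T.Elem :=
  Finset.univ.filter fun K' => hull K'.1 ⊆ closedBall (barycenter K.1) R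

theorem mem_near {R : ℝ} {K K' : T.Elem} :
    K' ∈ T.near R K ↔ hull K'.1 ⊆ closedBall (barycenter K.1) R := by
  simp [near]

open Classical in
/-- The sum of squares of the jumps of a piecewise constant function on the facets of an element. -/
def jumpSq (T : Triangulation Ω) (v : T.PiecewiseConst) (K : T.Elem) : ℝ :=
  ∑ e ∈ T.facets with e ⊆ K.1, ‖T.jump v.toBroken e 0‖ ^ 2

theorem jumpSq_nonneg (v : T.PiecewiseConst) (K : T.Elem) : 0 ≤ T.jumpSq v K :=
  Finset.sum_nonneg fun _ _ => by positivity

namespace IsRegular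

variable {c h : ℝ}

theorem card_near_le (hT : T.IsRegular c h) {D : ℝ} (hD : 0 ≤ D) (K : T.Elem) :
    ((T.near (D * h) K).card : ℝ) ≤ (D / c) ^ d :=
  hT.card_le _ _ hD fun _ hK => mem_near.1 hK

-- The dual count: these `K` all lie within `(D + 1) * h` of the barycenter of `K'`. It bounds
-- multiplicities when sums over neighbourhoods are exchanged.
open Classical in
theorem card_near_le' (hT : T.IsRegular c h) {D : ℝ} (hD : 0 ≤ D) (K' : T.Elem) :
    ((Finset.univ.filter fun K => K' ∈ T.near (D * h) K).card : ℝ) ≤ ((D + 1) / c) ^ d := by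
  refine hT.card_le _ (barycenter K'.1) (by positivity) fun K hK x hx => ?_
  have h1 := mem_near.1 (Finset.mem_filter.1 hK).2 (barycenter_mem K')
  have h2 := hT.dist_le K hx (barycenter_mem K)
  rw [mem_closedBall] at h1 ⊢
  rw [dist_comm] at h1
  linarith [dist_triangle x (barycenter K.1) (barycenter K'.1)]

/-- The difference of the values of a piecewise constant function on two elements is bounded by the
jumps in between. -/
theorem sq_sub_le (hT : T.IsRegular c h) (hd : 1 ≤ d) (hΩ : IsConvexPolytopalDomain Ω) {D : ℝ}
    (hD : 1 ≤ D) {K K' : T.Elem} (hK : K' ∈ T.near (D * h) K) (v : T.PiecewiseConst) :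
    (v K - v K') ^ 2 ≤
      (((D + 1) / c) ^ d) ^ 2 * ∑ L ∈ T.near ((D + 1) * h) K, T.jumpSq v L := by
  classical
  have hh := hT.pos
  obtain ⟨x, hx, y, hy, hskel⟩ := hT.exists_segment K K'
  have hconv : Convex ℝ (closure Ω) := by
    obtain ⟨-, V, rfl⟩ := hΩ
    exact (convex_convexHull ℝ _).interior.closure
  have hopen : IsOpen Ω := by
    obtain ⟨-, V, rfl⟩ := hΩ
    exact isOpen_interior
  have hhull : ∀ L : T.Elem, hull L.1 ⊆ closure Ω := fun L => by
    rw [← T.space_eq]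
    exact Set.subset_biUnion_of_mem (u := fun s : Finset (Rd d) => convexHull ℝ (s : Set (Rd d)))
      L.mem_faces
  have hseg : segment ℝ x y ⊆ closure Ω := hconv.segment_subset (hhull K hx) (hhull K' hy)
  have hball : segment ℝ x y ⊆ closedBall (barycenter K.1) (D * h) := by
    refine (convex_closedBall _ _).segment_subset ?_ (mem_near.1 hK hy)
    rw [mem_closedBall]
    exact (hT.dist_le K hx (barycenter_mem K)).trans (by nlinarith)
  have hmeet : ∀ L ∈ T.meeting (segment ℝ x y), L ∈ T.near ((D + 1) * h) K := by
    rintro L ⟨z, hz, hzL⟩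
    refine mem_near.2 fun w hw => ?_
    have h1 := mem_closedBall.1 (hball hz)
    have h2 := hT.dist_le L hw hzL
    rw [mem_closedBall]
    linarith [dist_triangle w z (barycenter K.1)]
  let K₀ : T.meeting (segment ℝ x y) := ⟨K, x, left_mem_segment ℝ x y, hx⟩
  let K₁ : T.meeting (segment ℝ x y) := ⟨K', y, right_mem_segment ℝ x y, hy⟩
  obtain ⟨p, hp⟩ := (reachable_of_segment (convex_segment x y).isPreconnected
    (fun z hz => T.exists_elem_mem_hull hopen (hseg hz)) hskel K₀ K₁).exists_isPath
  set S := ∑ L ∈ T.near ((D + 1) * h) K, T.jumpSq v L with hS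
  have hS0 : 0 ≤ S := Finset.sum_nonneg fun _ _ => jumpSq_nonneg _ _
  have hadj : ∀ L L' : T.meeting (segment ℝ x y),
      (T.facetGraph.induce (T.meeting (segment ℝ x y))).Adj L L' →
        |v L.1 - v L'.1| ≤ √S := by
    rintro L L' ⟨hne, e, he, heL, heL'⟩
    refine Real.abs_le_sqrt ?_
    have hj : ‖T.jump v.toBroken e 0‖ = |v L.1 - v L'.1| :=
      hT.norm_jump_toBroken hd he hne heL heL' v 0
    rw [← sq_abs, ← hj]
    calc ‖T.jump v.toBroken e 0‖ ^ 2 ≤ T.jumpSq v L.1 :=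
          Finset.single_le_sum (f := fun e => ‖T.jump v.toBroken e 0‖ ^ 2)
            (fun _ _ => by positivity) (Finset.mem_filter.2 ⟨he, heL⟩)
      _ ≤ S := Finset.single_le_sum (f := fun L => T.jumpSq v L)
            (fun _ _ => jumpSq_nonneg _ _) (hmeet L.1 L.2)
  have h1 := abs_sub_le_length_mul (f := fun L : T.meeting (segment ℝ x y) => v L.1) hadj p
  -- A path repeats no vertex, so its length is at most the number of elements meeting the segment,
  -- all of them near `K`.
  have h2 : (p.length : ℝ) ≤ ((D + 1) / c) ^ d := by
    refine le_trans ?_ (hT.card_near_le (by linarith : 0 ≤ D + 1) K)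
    norm_cast
    refine hp.length_lt.le.trans ?_
    rw [← Set.toFinset_card]
    exact Finset.card_le_card fun L hL => hmeet L (by simpa using hL)
  have h3 : |v K - v K'| ≤ ((D + 1) / c) ^ d * √S :=
    h1.trans (mul_le_mul_of_nonneg_right h2 (Real.sqrt_nonneg _))
  have h4 := pow_le_pow_left₀ (abs_nonneg _) h3 2
  rwa [sq_abs, mul_pow, Real.sq_sqrt hS0] at h4

/-- Differences over neighbourhoods of comparable size are controlled by the jumps. -/
theorem sum_sum_sq_sub_le (hT : T.IsRegular c h) (hd : 1 ≤ d) (hΩ : IsConvexPolytopalDomain Ω)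
    {D : ℝ} (hD : 1 ≤ D) (v : T.PiecewiseConst) :
    ∑ K, ∑ K' ∈ T.near (D * h) K, (v K - v K') ^ 2 ≤
      2 * (((D + 2) / c) ^ d) ^ 4 * ∑ e ∈ T.facets, ‖T.jump v.toBroken e 0‖ ^ 2 := by
  classical
  have hc := hT.pos_const
  set M := ((D + 2) / c) ^ d with hM
  have hM0 : 0 ≤ M := by positivity
  have hM1 : ((D + 1) / c) ^ d ≤ M := by rw [hM]; gcongr; linarith
  have hM2 : (D / c) ^ d ≤ M := by rw [hM]; gcongr; linarith
  calc ∑ K, ∑ K' ∈ T.near (D * h) K, (v K - v K') ^ 2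
      -- `M ^ 2` comes from the estimate for one pair, the third `M` from the number of elements
      -- `K'`.
      ≤ ∑ K, M ^ 3 * ∑ L ∈ T.near ((D + 1) * h) K, T.jumpSq v L := by
        refine Finset.sum_le_sum fun K _ => ?_
        have hS0 : 0 ≤ ∑ L ∈ T.near ((D + 1) * h) K, T.jumpSq v L :=
          Finset.sum_nonneg fun _ _ => jumpSq_nonneg _ _
        have h1 : ∀ K' ∈ T.near (D * h) K, (v K - v K') ^ 2 ≤
            M ^ 2 * ∑ L ∈ T.near ((D + 1) * h) K, T.jumpSq v L := fun K' hK' =>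
          (hT.sq_sub_le hd hΩ hD hK' v).trans (by gcongr)
        refine (Finset.sum_le_card_nsmul _ _ _ h1).trans ?_
        rw [nsmul_eq_mul]
        calc _ ≤ M * (M ^ 2 * ∑ L ∈ T.near ((D + 1) * h) K, T.jumpSq v L) := by
              gcongr
              exact (hT.card_near_le (by linarith) K).trans hM2
          _ = _ := by ring
    -- After the exchange each `L` is counted at most `M` times, and then each facet at most twice.
    _ = M ^ 3 * ∑ L, ∑ K with L ∈ T.near ((D + 1) * h) K, T.jumpSq v L := by
        rw [← Finset.mul_sum]
        congr 1
        refine Finset.sum_comm' fun K L => ?_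
        simp
    _ ≤ M ^ 3 * ∑ L, M * T.jumpSq v L := by
        gcongr with L _
        rw [Finset.sum_const, nsmul_eq_mul]
        refine mul_le_mul_of_nonneg_right ?_ (jumpSq_nonneg _ _)
        refine (hT.card_near_le' (by linarith) L).trans (le_of_eq ?_)
        rw [hM]
        ring
    _ = M ^ 4 * ∑ e ∈ T.facets, ∑ L : T.Elem with e ⊆ L.1, ‖T.jump v.toBroken e 0‖ ^ 2 := by
        rw [← Finset.mul_sum, ← mul_assoc, ← pow_succ]
        congr 1
        refine Finset.sum_comm' fun K L => ?_
        simp [and_comm]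
    _ ≤ M ^ 4 * ∑ e ∈ T.facets, 2 * ‖T.jump v.toBroken e 0‖ ^ 2 := by
        gcongr with e he
        rw [Finset.sum_const, nsmul_eq_mul]
        refine mul_le_mul_of_nonneg_right ?_ (by positivity)
        exact_mod_cast hT.card_filter_facet_le hd he
    _ = _ := by rw [← Finset.mul_sum]; ring

end IsRegular

end Triangulation

end

/-! ### Patches, the constant `Λ_m` and the local reconstruction -/

section

variable {d : ℕ}

theorem maxAbs_le {p : MvPolynomial (Fin d) ℝ} {S : Set (Rd d)} {B : ℝ} (hB : 0 ≤ B)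
    (h : ∀ x ∈ S, |polyVal p x| ≤ B) : maxAbs p S ≤ B := by
  refine Real.sSup_le ?_ hB
  rintro _ ⟨x, hx, rfl⟩
  exact h x hx

theorem abs_polyVal_le_maxAbs {p : MvPolynomial (Fin d) ℝ} {S : Set (Rd d)} (hS : IsCompact S)
    {x : Rd d} (hx : x ∈ S) : |polyVal p x| ≤ maxAbs p S :=
  le_csSup (hS.image (continuous_polyVal p).abs).bddAbove (Set.mem_image_of_mem _ hx)

theorem maxAbs_nonneg (p : MvPolynomial (Fin d) ℝ) (S : Set (Rd d)) : 0 ≤ maxAbs p S := by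
  refine Real.sSup_nonneg ?_
  rintro _ ⟨x, -, rfl⟩
  exact abs_nonneg _

theorem maxAbs_one {S : Set (Rd d)} (hS : S.Nonempty) :
    maxAbs (1 : MvPolynomial (Fin d) ℝ) S = 1 := by
  have h : (fun x => |polyVal (1 : MvPolynomial (Fin d) ℝ) x|) = fun _ : Rd d => (1 : ℝ) := by
    ext x
    simp [polyVal]
  rw [maxAbs, h, hS.image_const, csSup_singleton]

namespace Triangulation

variable {Ω : Set (Rd d)} {T : Triangulation Ω}

theorem mem_nbhd_self (K : T.Elem) : K ∈ T.nbhd K := by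
  simp only [nbhd, Finset.mem_filter, Finset.mem_univ, true_and, Set.inter_self]
  exact ⟨_, barycenter_mem_hull K.nonempty⟩

theorem layer_subset_succ (K : T.Elem) (t : ℕ) : T.layer K t ⊆ T.layer K (t + 1) := by
  intro L hL
  rw [layer, Finset.mem_biUnion]
  exact ⟨L, hL, mem_nbhd_self L⟩

theorem self_mem_layer (K : T.Elem) (t : ℕ) : K ∈ T.layer K t := by
  induction t with
  | zero => simp [layer]
  | succ t ih => exact layer_subset_succ K t ih

theorem layer_eq_of_eq_succ {K : T.Elem} {s : ℕ} (h : T.layer K (s + 1) = T.layer K s) {t : ℕ}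
    (ht : s ≤ t) : T.layer K t = T.layer K s := by
  induction t, ht using Nat.le_induction with
  | base => rfl
  | succ t _ ih => rw [layer, ih, ← layer, h]

/-- The number of layers of a patch is at most the threshold. -/
theorem sInf_layer_le (T : Triangulation Ω) (N : ℕ) (K : T.Elem) :
    sInf {t : ℕ | N ≤ (T.layer K t).card} ≤ N := by
  set A := {t : ℕ | N ≤ (T.layer K t).card} with hA
  rcases A.eq_empty_or_nonempty with h | h
  · simp [h]
  have hmem : N ≤ (T.layer K (sInf A)).card := Nat.sInf_mem h
  have hlt : ∀ s < sInf A, (T.layer K s).card < N := fun s hs =>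
    not_le.1 fun hle => Nat.notMem_of_lt_sInf hs hle
  -- Before the threshold is reached the layers grow strictly, since a layer equal to its successor
  -- stays constant and would never reach `N`. Hence the cardinality exceeds the index.
  have hcard : ∀ s < sInf A, s + 1 ≤ (T.layer K s).card := by
    intro s
    induction s with
    | zero => intro _; simp [layer]
    | succ s ih =>
      intro hs
      have h1 := ih (by lia)
      have h2 : T.layer K s ⊂ T.layer K (s + 1) := by
        refine (layer_subset_succ K s).ssubset_of_ne fun heq => ?_
        have h3 := hlt s (by lia)
        rw [layer_eq_of_eq_succ heq.symm (by lia : s ≤ sInf A)] at hmem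
        lia
      exact Nat.succ_le_of_lt (h1.trans_lt (Finset.card_lt_card h2))
  by_contra! hN
  have h1 := hcard (sInf A - 1) (by lia)
  have h2 := hlt (sInf A - 1) (by lia)
  lia

theorem self_mem_patch (N : ℕ) (K : T.Elem) : K ∈ T.patch N K := self_mem_layer K _

theorem hull_subset_patchRegion (N : ℕ) (K : T.Elem) : hull K.1 ⊆ T.patchRegion N K :=
  Set.subset_biUnion_of_mem (u := fun L : T.Elem => hull L.1) (self_mem_patch N K)

theorem IsRegular.layer_subset_near {c h : ℝ} (hT : T.IsRegular c h) (K : T.Elem) (t : ℕ) :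
    T.layer K t ⊆ T.near ((t + 1) * h) K := by
  induction t with
  | zero =>
    intro L hL
    rw [layer, Finset.mem_singleton] at hL
    subst hL
    refine mem_near.2 fun x hx => mem_closedBall.2 ?_
    have := hT.dist_le L hx (IsRegular.barycenter_mem L)
    simpa using this
  | succ t ih =>
    intro L hL
    rw [layer, Finset.mem_biUnion] at hL
    obtain ⟨L', hL', hLL⟩ := hL
    obtain ⟨z, hz', hz⟩ := by simpa [nbhd] using hLL
    have h1 := mem_closedBall.1 (mem_near.1 (ih hL') hz')
    refine mem_near.2 fun x hx => mem_closedBall.2 ?_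
    have h2 := hT.dist_le L hx hz
    push_cast
    linarith [dist_triangle x z (barycenter K.1)]

theorem IsRegular.patch_subset_near {c h : ℝ} (hT : T.IsRegular c h) (N : ℕ) (K : T.Elem) :
    T.patch N K ⊆ T.near ((N + 1) * h) K := by
  refine (hT.layer_subset_near K _).trans fun L hL => ?_
  refine mem_near.2 ((mem_near.1 hL).trans (closedBall_subset_closedBall ?_))
  have h1 : ((sInf {t : ℕ | N ≤ (T.layer K t).card} : ℕ) : ℝ) ≤ N := by
    exact_mod_cast T.sInf_layer_le N K
  have := hT.pos
  gcongr

theorem isCompact_patchRegion (N : ℕ) (K : T.Elem) : IsCompact (T.patchRegion N K) :=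
  (T.patch N K).finite_toSet.isCompact_biUnion fun L _ => isCompact_hull L.1

theorem finite_collocation (N : ℕ) (K : T.Elem) : (T.collocation N K).Finite := by
  refine (((T.patch N K).finite_toSet).image fun L : T.Elem => barycenter L.1).subset ?_
  rintro _ ⟨L, hL, rfl⟩
  exact ⟨L, hL, rfl⟩

theorem barycenter_mem_collocation {N : ℕ} {K L : T.Elem} (hL : L ∈ T.patch N K) :
    barycenter L.1 ∈ T.collocation N K := ⟨L, hL, rfl⟩

/-- The ratios defining `Λ(m, K)` are bounded. -/
theorem IsRegular.bddAbove_lambda {c h : ℝ} (hT : T.IsRegular c h) {m N : ℕ}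
    (hu : T.Unisolvent m N) (K : T.Elem) :
    BddAbove (Set.range fun p : {p : MvPolynomial (Fin d) ℝ // p.totalDegree ≤ m} =>
      maxAbs p.1 (T.patchRegion N K) / maxAbs p.1 (T.collocation N K)) := by
  let Φ : MvPolynomial.restrictTotalDegree (Fin d) ℝ m →ₗ[ℝ] (T.patch N K → ℝ) :=
    { toFun := fun p L => polyVal p.1 (barycenter L.1.1)
      map_add' := fun p q => by ext; simp [polyVal]
      map_smul' := fun a p => by ext; simp [polyVal] }
  -- Unisolvence gives vanishing on the patch, which contains a ball. The values at the collocation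
  -- points thus define a norm. Without boundedness the supremum `Λ(m, K)` would take its default
  -- value 0.
  have hΦ : Function.Injective Φ := by
    rw [injective_iff_map_eq_zero]
    intro p hp
    ext1
    obtain ⟨x, hx⟩ := hT.exists_ball K
    refine eq_zero_of_polyVal_eq_zero (x := x) (mul_pos hT.pos_const hT.pos) fun y hy => ?_
    refine hu K p.1 ((MvPolynomial.mem_restrictTotalDegree _ _ _).1 p.2) ?_ y
      (hull_subset_patchRegion N K (hx (ball_subset_closedBall hy)))
    rintro _ ⟨L, hL, rfl⟩
    exact congrFun hp ⟨L, hL⟩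
  obtain ⟨R, hR⟩ := (isCompact_patchRegion N K).isBounded.subset_closedBall 0
  obtain ⟨C, hC, hb⟩ := exists_norm_le_of_injective Φ hΦ (restrictBall m R)
  refine ⟨C, ?_⟩
  rintro _ ⟨⟨p, hp⟩, rfl⟩
  refine div_le_of_le_mul₀ (maxAbs_nonneg _ _) hC.le ?_
  let q : MvPolynomial.restrictTotalDegree (Fin d) ℝ m :=
    ⟨p, (MvPolynomial.mem_restrictTotalDegree _ _ _).2 hp⟩
  have h1 : ‖Φ q‖ ≤ maxAbs p (T.collocation N K) :=
    (pi_norm_le_iff_of_nonneg (maxAbs_nonneg _ _)).2 fun L =>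
      abs_polyVal_le_maxAbs (finite_collocation N K).isCompact (barycenter_mem_collocation L.2)
  refine maxAbs_le (mul_nonneg hC.le (maxAbs_nonneg _ _)) fun x hx => ?_
  have h2 := ContinuousMap.norm_coe_le_norm (restrictBall m R q) ⟨x, hR hx⟩
  exact h2.trans ((hb q).trans (mul_le_mul_of_nonneg_left h1 hC.le))

theorem lambdaLoc_le_lambda (m N : ℕ) (K : T.Elem) : T.LambdaLoc m N K ≤ T.Lambda m N :=
  le_ciSup (f := fun K : T.Elem => T.LambdaLoc m N K) (Set.finite_range _).bddAbove K

/-- The test polynomial is the constant 1. The bound allows terms without `Λ_m` to be absorbed in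
the stability estimate. -/
theorem IsRegular.one_le_lambda {c h : ℝ} (hT : T.IsRegular c h) {m N : ℕ}
    (hu : T.Unisolvent m N) (K : T.Elem) : 1 ≤ T.Lambda m N := by
  refine le_trans ?_ (lambdaLoc_le_lambda m N K)
  have h1 := le_ciSup (hT.bddAbove_lambda hu K) ⟨1, by simp⟩
  simp only at h1
  rwa [maxAbs_one ⟨_, hull_subset_patchRegion N K (barycenter_mem_hull K.nonempty)⟩,
    maxAbs_one ⟨_, barycenter_mem_collocation (self_mem_patch N K)⟩, div_one] at h1

/-- If `p` vanishes at all collocation points, its quotient carries no information, and unisolvence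
is used instead. -/
theorem IsRegular.abs_polyVal_le_lambda_mul {c h : ℝ} (hT : T.IsRegular c h) {m N : ℕ}
    (hu : T.Unisolvent m N) (K : T.Elem) {p : MvPolynomial (Fin d) ℝ} (hp : p.totalDegree ≤ m)
    {B : ℝ} (hB : ∀ L ∈ T.patch N K, |polyVal p (barycenter L.1)| ≤ B) {x : Rd d}
    (hx : x ∈ T.patchRegion N K) : |polyVal p x| ≤ T.Lambda m N * B := by
  have hB0 : 0 ≤ B := (abs_nonneg _).trans (hB K (self_mem_patch N K))
  have hΛ : 0 ≤ T.Lambda m N := zero_le_one.trans (hT.one_le_lambda hu K)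
  have h1 : maxAbs p (T.collocation N K) ≤ B := by
    refine maxAbs_le hB0 ?_
    rintro _ ⟨L, hL, rfl⟩
    exact hB L hL
  rcases (maxAbs_nonneg p (T.collocation N K)).eq_or_lt with h0 | h0
  · rw [hu K p hp (fun y hy => ?_) x hx, abs_zero]
    · positivity
    · have := abs_polyVal_le_maxAbs (p := p) (finite_collocation N K).isCompact hy
      rw [← h0] at this
      exact abs_nonpos_iff.1 this
  · have h2 := (le_ciSup (hT.bddAbove_lambda hu K) ⟨p, hp⟩).trans (lambdaLoc_le_lambda m N K)
    simp only at h2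
    rw [div_le_iff₀ h0] at h2
    exact (abs_polyVal_le_maxAbs (isCompact_patchRegion N K) hx).trans
      (h2.trans (mul_le_mul_of_nonneg_left h1 hΛ))

theorem localRecon_spec (m N : ℕ) (v : T.PiecewiseConst) (K : T.Elem) :
    T.IsLeastSquaresSol m N v K (T.localRecon m N v K) :=
  Classical.choose_spec (T.exists_leastSquaresSol m N v K)

/-- The reconstruction is close to the given constant, up to the differences on the patch. -/
theorem IsRegular.recon_sub_sq_le {c h : ℝ} (hT : T.IsRegular c h) {m N : ℕ}
    (hu : T.Unisolvent m N) (v : T.PiecewiseConst) (K : T.Elem) {x : Rd d}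
    (hx : x ∈ T.patchRegion N K) :
    (T.recon m N v K x - v K) ^ 2 ≤
      4 * T.Lambda m N ^ 2 * ∑ L ∈ T.patch N K, (v K - v L) ^ 2 := by
  obtain ⟨⟨hdeg, hval⟩, hmin⟩ := localRecon_spec m N v K
  rw [recon]
  set p := T.localRecon m N v K
  set S := ∑ L ∈ T.patch N K, (v K - v L) ^ 2 with hS
  have hS0 : 0 ≤ S := Finset.sum_nonneg fun _ _ => sq_nonneg _
  have h1 : ∑ L ∈ T.patch N K, (polyVal p (barycenter L.1) - v L) ^ 2 ≤ S := by
    -- The constant `v K` is an admissible competitor, and its residual is exactly `S`.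
    have := hmin (MvPolynomial.C (v K)) (by simp) (by simp [polyVal])
    simpa [polyVal, hS] using this
  have hsub : ∀ y, polyVal (p - MvPolynomial.C (v K)) y = polyVal p y - v K := fun y => by
    simp [polyVal]
  have h2 : ∀ L ∈ T.patch N K,
      |polyVal (p - MvPolynomial.C (v K)) (barycenter L.1)| ≤ √(4 * S) := by
    intro L hL
    refine Real.abs_le_sqrt ?_
    rw [hsub]
    have h3 := (Finset.single_le_sum (f := fun L : T.Elem => (polyVal p (barycenter L.1) - v L) ^ 2)
      (fun _ _ => sq_nonneg _) hL).trans h1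
    have h4 := Finset.single_le_sum (f := fun L : T.Elem => (v K - v L) ^ 2)
      (fun _ _ => sq_nonneg _) hL
    rw [← hS] at h4
    -- `p(x_L) - v_K` is the difference of `p(x_L) - v_L` and `v_K - v_L`, each with square at most
    -- `S`, whence `4 * S`.
    nlinarith [sq_nonneg (polyVal p (barycenter L.1) - v L + (v K - v L))]
  have h5 := hT.abs_polyVal_le_lambda_mul hu K
    ((MvPolynomial.totalDegree_sub _ _).trans (max_le hdeg (by simp))) h2 hx
  rw [hsub] at h5
  have h6 := pow_le_pow_left₀ (abs_nonneg _) h5 2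
  rw [sq_abs, mul_pow, Real.sq_sqrt (by positivity)] at h6
  linarith

end Triangulation

end

/-! ### Comparison of energies and the two bounds -/

section

namespace Triangulation

variable {d : ℕ} {Ω : Set (Rd d)} {T : Triangulation Ω}

/-- The gradient part of the squared energy norm. -/
def gradPart (T : Triangulation Ω) (w : T.Broken) : ℝ :=
  ∑ K : T.Elem, ∫ x in hull K.1, ‖gradient (w K) x‖ ^ 2

/-- The contribution of a facet to the squared energy norm. -/
def facetPart (T : Triangulation Ω) (w : T.Broken) (e : Finset (Rd d)) : ℝ :=
  (hdiam e)⁻¹ * ∫ x in hull e, ‖T.jump w e x‖ ^ 2 ∂μHE[d - 1]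

theorem gradPart_nonneg (w : T.Broken) : 0 ≤ T.gradPart w :=
  Finset.sum_nonneg fun _ _ => integral_nonneg fun _ => by positivity

theorem facetPart_nonneg (w : T.Broken) (e : Finset (Rd d)) : 0 ≤ T.facetPart w e :=
  mul_nonneg (inv_nonneg.2 diam_nonneg) (integral_nonneg fun _ => by positivity)

theorem energyNorm_eq (w : T.Broken) :
    T.energyNorm w = √(T.gradPart w + ∑ e ∈ T.facets, T.facetPart w e) := rfl

theorem gradPart_toBroken (v : T.PiecewiseConst) : T.gradPart v.toBroken = 0 := by
  refine Finset.sum_eq_zero fun K _ => ?_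
  have h : ∀ x, gradient (v.toBroken K) x = 0 := fun x => gradient_const x (v K)
  simp [h]

/-- Together with the next lemma this disposes of faces with `d` vertices lying in no element, so
purity of the complex need not be proved. -/
theorem jump_eq_zero {e : Finset (Rd d)} (he : ¬ ∃ K : T.Elem, e ⊆ K.1) (w : T.Broken) (x : Rd d) :
    T.jump w e x = 0 := by
  unfold jump
  refine Finset.sum_eq_zero fun K hK => ?_
  exact absurd ⟨K, (Finset.mem_filter.1 hK).2⟩ he

theorem facetPart_eq_zero {e : Finset (Rd d)} (he : ¬ ∃ K : T.Elem, e ⊆ K.1) (w : T.Broken) :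
    T.facetPart w e = 0 := by
  simp [facetPart, jump_eq_zero he]

theorem continuous_jump {w : T.Broken} (hw : ∀ K, Continuous (w K)) (e : Finset (Rd d)) :
    Continuous (T.jump w e) := by
  unfold jump
  exact continuous_finsetSum _ fun K _ => (hw K).smul continuous_const

theorem integrableOn_hull {n : ℕ} {e : Finset (Rd d)} (he : μHE[n] (hull e) < ⊤)
    {f : Rd d → ℝ} (hf : Continuous f) : IntegrableOn f (hull e) μHE[n] := by
  obtain ⟨C, hC⟩ := (isCompact_hull e).exists_bound_of_continuousOn hf.continuousOn
  refine Measure.integrableOn_of_bounded he.ne hf.aestronglyMeasurable (M := C) ?_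
  exact ae_restrict_of_forall_mem (isCompact_hull e).isClosed.measurableSet hC

namespace IsRegular

variable {c h : ℝ}

-- The jump of `w₁ - w₂` has at most two terms with unit normals. One factor 2 is from
-- Cauchy–Schwarz, the other from `(a + b)² ≤ 2a² + 2b²`.
open Classical in
theorem norm_jump_sq_le (hT : T.IsRegular c h) (hd : 1 ≤ d) {w₁ w₂ : T.Broken} {B : T.Elem → ℝ}
    (hB : ∀ K, ∀ x ∈ hull K.1, (w₁ K x - w₂ K x) ^ 2 ≤ B K) {e : Finset (Rd d)} (he : e ∈ T.facets)
    {x : Rd d} (hx : x ∈ hull e) :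
    ‖T.jump w₁ e x‖ ^ 2 ≤ 2 * ‖T.jump w₂ e x‖ ^ 2 + 4 * ∑ K : T.Elem with e ⊆ K.1, B K := by
  set F := Finset.univ.filter fun K : T.Elem => e ⊆ K.1 with hF
  have hmem : ∀ K ∈ F, e ⊆ K.1 := fun K hK => (Finset.mem_filter.1 hK).2
  have h1 : T.jump w₁ e x - T.jump w₂ e x =
      ∑ K ∈ F, (w₁ K x - w₂ K x) • outwardNormal K.1 e := by
    simp only [jump, sub_smul, Finset.sum_sub_distrib, hF]
  have h2 : ‖T.jump w₁ e x - T.jump w₂ e x‖ ≤ ∑ K ∈ F, |w₁ K x - w₂ K x| := by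
    rw [h1]
    refine (norm_sum_le _ _).trans (Finset.sum_le_sum fun K hK => ?_)
    rw [norm_smul, norm_normal hd he K (hmem K hK), mul_one, Real.norm_eq_abs]
  have h3 : ‖T.jump w₁ e x - T.jump w₂ e x‖ ^ 2 ≤ 2 * ∑ K ∈ F, B K := by
    calc ‖T.jump w₁ e x - T.jump w₂ e x‖ ^ 2 ≤ (∑ K ∈ F, |w₁ K x - w₂ K x|) ^ 2 := by gcongr
      _ ≤ F.card * ∑ K ∈ F, |w₁ K x - w₂ K x| ^ 2 := sq_sum_le_card_mul_sum_sq
      _ ≤ 2 * ∑ K ∈ F, B K := by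
          have h4 : (F.card : ℝ) ≤ 2 := by exact_mod_cast hT.card_filter_facet_le hd he
          gcongr with K hK
          rw [sq_abs]
          exact hB K x (hull_mono (hmem K hK) hx)
  have h5 : ‖T.jump w₁ e x‖ ≤ ‖T.jump w₂ e x‖ + ‖T.jump w₁ e x - T.jump w₂ e x‖ := by
    have := norm_add_le (T.jump w₂ e x) (T.jump w₁ e x - T.jump w₂ e x)
    rwa [add_sub_cancel] at this
  have h6 := pow_le_pow_left₀ (norm_nonneg _) h5 2
  nlinarith [sq_nonneg (‖T.jump w₂ e x‖ - ‖T.jump w₁ e x - T.jump w₂ e x‖)]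

open Classical in
theorem facetPart_le (hT : T.IsRegular c h) (hd : 2 ≤ d) {w₁ w₂ : T.Broken}
    (hw₁ : ∀ K, Continuous (w₁ K)) (hw₂ : ∀ K, Continuous (w₂ K)) {B : T.Elem → ℝ}
    (hB : ∀ K, ∀ x ∈ hull K.1, (w₁ K x - w₂ K x) ^ 2 ≤ B K) {e : Finset (Rd d)}
    (he : e ∈ T.facets) :
    T.facetPart w₁ e ≤ 2 * T.facetPart w₂ e +
      4 * (c⁻¹ * unitBallVolume (d - 1)) * (h ^ (d - 2) * ∑ K : T.Elem with e ⊆ K.1, B K) := by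
  by_cases hex : ∃ K : T.Elem, e ⊆ K.1
  · obtain ⟨K, heK⟩ := hex
    obtain ⟨x, hx⟩ := hT.exists_ball K
    obtain ⟨hfin, -, hup⟩ := scaled_measure_facet_bounds K.indep K.card_eq heK
      (card_of_mem_facets he) hd hT.pos_const hT.pos hx (hT.diam_le K)
    set S := ∑ K : T.Elem with e ⊆ K.1, B K with hS
    have hS0 : 0 ≤ S := Finset.sum_nonneg fun L _ =>
      (sq_nonneg _).trans (hB L _ (barycenter_mem L))
    have hi₁ := integrableOn_hull hfin ((continuous_jump hw₁ e).norm.pow 2)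
    have hi₂ : IntegrableOn (fun x => 2 * ‖T.jump w₂ e x‖ ^ 2) (hull e) μHE[d - 1] :=
      (integrableOn_hull hfin ((continuous_jump hw₂ e).norm.pow 2)).const_mul 2
    have hi₃ := integrableOn_hull hfin (continuous_const (y := 4 * S))
    have h1 : ∫ x in hull e, ‖T.jump w₁ e x‖ ^ 2 ∂μHE[d - 1] ≤
        ∫ x in hull e, (2 * ‖T.jump w₂ e x‖ ^ 2 + 4 * S) ∂μHE[d - 1] :=
      setIntegral_mono_on hi₁ (hi₂.add hi₃) (isCompact_hull e).isClosed.measurableSet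
        fun x hx => hT.norm_jump_sq_le (by lia) hB he hx
    rw [integral_add hi₂ hi₃, integral_const_mul, setIntegral_const, smul_eq_mul] at h1
    have hinv : 0 ≤ (hdiam e)⁻¹ := inv_nonneg.2 diam_nonneg
    calc T.facetPart w₁ e ≤ (hdiam e)⁻¹ * (2 * ∫ x in hull e, ‖T.jump w₂ e x‖ ^ 2 ∂μHE[d - 1] +
          μHE[d - 1].real (hull e) * (4 * S)) := mul_le_mul_of_nonneg_left h1 hinv
      _ = 2 * T.facetPart w₂ e + (hdiam e)⁻¹ * μHE[d - 1].real (hull e) * (4 * S) := by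
          rw [facetPart]; ring
      _ ≤ 2 * T.facetPart w₂ e + c⁻¹ * unitBallVolume (d - 1) * h ^ (d - 2) * (4 * S) := by
          gcongr
      _ = _ := by ring
  · have hF : (Finset.univ.filter fun K : T.Elem => e ⊆ K.1) = ∅ :=
      Finset.filter_eq_empty_iff.2 fun K _ heK => hex ⟨K, heK⟩
    rw [facetPart_eq_zero hex, facetPart_eq_zero hex, hF]
    simp

theorem sum_facetPart_le (hT : T.IsRegular c h) (hd : 2 ≤ d) {w₁ w₂ : T.Broken}
    (hw₁ : ∀ K, Continuous (w₁ K)) (hw₂ : ∀ K, Continuous (w₂ K)) {B : T.Elem → ℝ}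
    (hB : ∀ K, ∀ x ∈ hull K.1, (w₁ K x - w₂ K x) ^ 2 ≤ B K) :
    ∑ e ∈ T.facets, T.facetPart w₁ e ≤ 2 * ∑ e ∈ T.facets, T.facetPart w₂ e +
      4 * (c⁻¹ * unitBallVolume (d - 1)) * 2 ^ (d + 1) * (h ^ (d - 2) * ∑ K, B K) := by
  classical
  have hc := hT.pos_const
  have hh := hT.pos
  have hω := unitBallVolume_pos (d - 1)
  have hB0 : ∀ K, 0 ≤ B K := fun K => (sq_nonneg _).trans (hB K _ (barycenter_mem K))
  have h1 := Finset.sum_le_sum fun e he => hT.facetPart_le hd hw₁ hw₂ hB (e := e) he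
  refine h1.trans ?_
  rw [Finset.sum_add_distrib, ← Finset.mul_sum, ← Finset.mul_sum, ← Finset.mul_sum]
  -- A crude count suffices: an element has `2 ^ (d + 1)` subsets of vertices, so at most that many
  -- facets.
  have h2 : ∑ e ∈ T.facets, ∑ K : T.Elem with e ⊆ K.1, B K ≤ 2 ^ (d + 1) * ∑ K, B K := by
    calc ∑ e ∈ T.facets, ∑ K : T.Elem with e ⊆ K.1, B K
        = ∑ K : T.Elem, ∑ e ∈ T.facets with e ⊆ K.1, B K := by
          refine Finset.sum_comm' fun e K => ?_
          simp [and_comm]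
      _ ≤ ∑ K : T.Elem, 2 ^ (d + 1) * B K := by
          refine Finset.sum_le_sum fun K _ => ?_
          rw [Finset.sum_const, nsmul_eq_mul]
          refine mul_le_mul_of_nonneg_right ?_ (hB0 K)
          have h3 : (T.facets.filter fun e => e ⊆ K.1).card ≤ K.1.powerset.card :=
            Finset.card_le_card fun e he => Finset.mem_powerset.2 (Finset.mem_filter.1 he).2
          rw [Finset.card_powerset, K.card_eq] at h3
          exact_mod_cast h3
      _ = _ := by rw [← Finset.mul_sum]
  calc _ ≤ 2 * ∑ e ∈ T.facets, T.facetPart w₂ e + 4 * (c⁻¹ * unitBallVolume (d - 1)) *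
        (h ^ (d - 2) * (2 ^ (d + 1) * ∑ K, B K)) := by gcongr
    _ = _ := by ring

/-- The jump of a piecewise constant function is constant on a facet, so the lower bound for `h_e⁻¹
|e|` applies directly. -/
theorem jump_sq_le_facetPart (hT : T.IsRegular c h) (hd : 2 ≤ d) (v : T.PiecewiseConst)
    {e : Finset (Rd d)} (he : e ∈ T.facets) :
    c ^ (d - 1) * unitBallVolume (d - 1) * (h ^ (d - 2) * ‖T.jump v.toBroken e 0‖ ^ 2) ≤
      T.facetPart v.toBroken e := by
  by_cases hex : ∃ K : T.Elem, e ⊆ K.1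
  · obtain ⟨K, heK⟩ := hex
    obtain ⟨x, hx⟩ := hT.exists_ball K
    obtain ⟨-, hlow, -⟩ := scaled_measure_facet_bounds K.indep K.card_eq heK
      (card_of_mem_facets he) hd hT.pos_const hT.pos hx (hT.diam_le K)
    have h1 : T.facetPart v.toBroken e =
        (hdiam e)⁻¹ * μHE[d - 1].real (hull e) * ‖T.jump v.toBroken e 0‖ ^ 2 := by
      have h2 : ∀ x, T.jump v.toBroken e x = T.jump v.toBroken e 0 := fun x => rfl
      rw [facetPart]
      simp_rw [h2]
      rw [setIntegral_const, smul_eq_mul, mul_assoc]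
    rw [h1, ← mul_assoc]
    gcongr
  · rw [facetPart_eq_zero hex, jump_eq_zero hex]
    simp

end IsRegular

theorem continuous_recon (m N : ℕ) (v : T.PiecewiseConst) (K : T.Elem) :
    Continuous (T.recon m N v K) := continuous_polyVal _

theorem sqrt_le_mul_sqrt_of_le_sq_mul {a b A : ℝ} (hA : 0 ≤ A) (h : a ≤ A ^ 2 * b) : √a ≤ A * √b := by
  refine (Real.sqrt_le_sqrt h).trans ?_
  rw [Real.sqrt_mul (sq_nonneg A), Real.sqrt_sq hA]

/-- The reconstruction does not decrease the energy norm, up to a constant. -/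
theorem exists_energyNorm_le_recon (d m N : ℕ) (hd : 2 ≤ d) {c : ℝ} (hc : 0 < c) :
    ∃ C : ℝ, 0 < C ∧ ∀ (Ω : Set (Rd d)) (T : Triangulation Ω) (h : ℝ), T.IsRegular c h →
      ∀ v : T.PiecewiseConst, T.energyNorm v.toBroken ≤ C * T.energyNorm (T.recon m N v) := by
  obtain ⟨C₁, hC₁, hosc⟩ := exists_oscillation_le d m hd hc
  have hω := unitBallVolume_pos (d - 1)
  set A := 4 * (c⁻¹ * unitBallVolume (d - 1)) * 2 ^ (d + 1) with hA
  have hA0 : 0 < A := by positivity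
  refine ⟨√(2 + A * C₁), by positivity, fun Ω T h hT v => ?_⟩
  have hh := hT.pos
  have hpow : 0 < h ^ (d - 2) := by positivity
  set w := T.recon m N v with hw
  -- The constraint replaces `v K` by the value of `w` at the barycenter, so the difference is an
  -- oscillation of a single polynomial.
  have hB : ∀ K : T.Elem, ∀ x ∈ hull K.1, (v.toBroken K x - w K x) ^ 2 ≤
      C₁ * (∫ z in hull K.1, ‖gradient (w K) z‖ ^ 2) / h ^ (d - 2) := by
    intro K x hx
    obtain ⟨a, ha⟩ := hT.exists_ball K
    have haK : a ∈ hull K.1 := ha (mem_closedBall_self (by positivity))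
    have h1 := hosc (hull K.1) a h hh (convex_hull _) (isCompact_hull _) ha
      (fun z hz => mem_closedBall.2 (hT.dist_le K hz haK)) _ (localRecon_spec m N v K).1.1 _
      (barycenter_mem_hull K.nonempty) x hx
    rw [(localRecon_spec m N v K).1.2] at h1
    rw [le_div_iff₀ hpow, mul_comm]
    exact h1
  have h2 := hT.sum_facetPart_le hd (fun K => continuous_const (y := v K))
    (continuous_recon m N v) hB
  rw [← Finset.sum_div, ← Finset.mul_sum, mul_div_cancel₀ _ hpow.ne'] at h2
  rw [energyNorm_eq, energyNorm_eq, gradPart_toBroken, zero_add]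
  refine sqrt_le_mul_sqrt_of_le_sq_mul (Real.sqrt_nonneg _) ?_
  rw [Real.sq_sqrt (by positivity)]
  have h3 := gradPart_nonneg w
  have h4 : 0 ≤ ∑ e ∈ T.facets, T.facetPart w e :=
    Finset.sum_nonneg fun _ _ => facetPart_nonneg _ _
  have h5 : A * (C₁ * T.gradPart w) = A * C₁ * T.gradPart w := by ring
  change _ ≤ 2 * _ + A * (C₁ * T.gradPart w) at h2
  have h6 : 0 ≤ A * C₁ := by positivity
  refine h2.trans ?_
  nlinarith [mul_nonneg h6 h4]

/-- Stability of the reconstruction in the energy norm. -/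
theorem exists_energyNorm_recon_le (d m N : ℕ) (hd : 2 ≤ d) {c : ℝ} (hc : 0 < c) :
    ∃ C : ℝ, 0 < C ∧ ∀ (Ω : Set (Rd d)), IsConvexPolytopalDomain Ω →
      ∀ (T : Triangulation Ω) (h : ℝ), T.IsRegular c h → T.Unisolvent m N →
      ∀ v : T.PiecewiseConst,
        T.energyNorm (T.recon m N v) ≤ C * T.Lambda m N * T.energyNorm v.toBroken := by
  obtain ⟨C₂, hC₂, hgrad⟩ := exists_integral_gradient_le d m hd hc
  have hω := unitBallVolume_pos (d - 1)
  set A := 4 * (c⁻¹ * unitBallVolume (d - 1)) * 2 ^ (d + 1) with hA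
  have hA0 : 0 < A := by positivity
  -- The constant of the discrete Poincaré estimate for `D = N + 1`, the radius of a patch in units
  -- of `h`.
  set M := 2 * (((((N : ℝ) + 1) + 2) / c) ^ d) ^ 4 with hM
  have hM0 : 0 < M := by positivity
  set c₁ := c ^ (d - 1) * unitBallVolume (d - 1) with hc₁
  have hc₁0 : 0 < c₁ := by positivity
  refine ⟨√(2 + (C₂ + A) * (4 * (M / c₁))), by positivity, fun Ω hΩ T h hT hu v => ?_⟩
  have hh := hT.pos
  have hpow : 0 < h ^ (d - 2) := by positivity
  obtain ⟨K₀⟩ := T.nonempty_elem hΩ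
  have hΛ := hT.one_le_lambda hu K₀
  set Λ := T.Lambda m N with hΛdef
  set w := T.recon m N v with hw
  let B : T.Elem → ℝ := fun K => 4 * Λ ^ 2 * ∑ L ∈ T.patch N K, (v K - v L) ^ 2
  have hB : ∀ K : T.Elem, ∀ x ∈ hull K.1, (w K x - v.toBroken K x) ^ 2 ≤ B K := fun K x hx =>
    hT.recon_sub_sq_le hu v K (hull_subset_patchRegion N K hx)
  set J := ∑ e ∈ T.facets, T.facetPart v.toBroken e with hJ
  have hJ0 : 0 ≤ J := Finset.sum_nonneg fun _ _ => facetPart_nonneg _ _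
  have hsumJ : h ^ (d - 2) * ∑ e ∈ T.facets, ‖T.jump v.toBroken e 0‖ ^ 2 ≤ J / c₁ := by
    rw [le_div_iff₀ hc₁0, Finset.mul_sum, Finset.sum_mul]
    refine Finset.sum_le_sum fun e he => ?_
    rw [mul_comm]
    exact hT.jump_sq_le_facetPart hd v he
  have hsumB : h ^ (d - 2) * ∑ K, B K ≤ 4 * Λ ^ 2 * (M / c₁ * J) := by
    have h1 : ∑ K, ∑ L ∈ T.patch N K, (v K - v L) ^ 2 ≤
        M * ∑ e ∈ T.facets, ‖T.jump v.toBroken e 0‖ ^ 2 := by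
      refine le_trans (Finset.sum_le_sum fun K _ => ?_) (hT.sum_sum_sq_sub_le (by lia) hΩ
        (by linarith [(Nat.cast_nonneg N : (0 : ℝ) ≤ N)] : (1 : ℝ) ≤ (N : ℝ) + 1) v)
      exact Finset.sum_le_sum_of_subset_of_nonneg (hT.patch_subset_near N K)
        fun _ _ _ => sq_nonneg _
    calc h ^ (d - 2) * ∑ K, B K
        = 4 * Λ ^ 2 * (h ^ (d - 2) * ∑ K, ∑ L ∈ T.patch N K, (v K - v L) ^ 2) := by
          rw [← Finset.mul_sum]; ring
      _ ≤ 4 * Λ ^ 2 * (h ^ (d - 2) * (M * ∑ e ∈ T.facets, ‖T.jump v.toBroken e 0‖ ^ 2)) := by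
          gcongr
      _ = 4 * Λ ^ 2 * (M * (h ^ (d - 2) * ∑ e ∈ T.facets, ‖T.jump v.toBroken e 0‖ ^ 2)) := by ring
      _ ≤ 4 * Λ ^ 2 * (M * (J / c₁)) := by gcongr
      _ = _ := by ring
  have hG : T.gradPart w ≤ C₂ * (h ^ (d - 2) * ∑ K, B K) := by
    rw [Finset.mul_sum, Finset.mul_sum]
    refine Finset.sum_le_sum fun K _ => ?_
    obtain ⟨a, ha⟩ := hT.exists_ball K
    have haK : a ∈ hull K.1 := ha (mem_closedBall_self (by positivity))
    exact hgrad (hull K.1) a h hh ha (fun z hz => mem_closedBall.2 (hT.dist_le K hz haK)) _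
      (localRecon_spec m N v K).1.1 (v K) (B K) (hB K)
  have hF := hT.sum_facetPart_le hd (continuous_recon m N v)
    (fun K => continuous_const (y := v K)) hB
  change ∑ e ∈ T.facets, T.facetPart w e ≤ 2 * J + A * (h ^ (d - 2) * ∑ K, B K) at hF
  rw [energyNorm_eq, energyNorm_eq, gradPart_toBroken, zero_add]
  refine sqrt_le_mul_sqrt_of_le_sq_mul (by positivity) ?_
  rw [mul_pow, Real.sq_sqrt (by positivity)]
  have hΛ2 : 1 ≤ Λ ^ 2 := one_le_pow₀ hΛ
  calc T.gradPart w + ∑ e ∈ T.facets, T.facetPart w e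
      ≤ 2 * J + (C₂ + A) * (h ^ (d - 2) * ∑ K, B K) := by linarith
    -- The term `2 * J` carries no `Λ`; it is absorbed by `Λ ≥ 1`.
    _ ≤ 2 * (Λ ^ 2 * J) + (C₂ + A) * (4 * Λ ^ 2 * (M / c₁ * J)) := by
        gcongr
        exact le_mul_of_one_le_left hJ0 hΛ2
    _ = _ := by ring

end Triangulation

end

end ReconstructedDG

end

theorem mainTheorem2 (d : ℕ) (hd : d = 2 ∨ d = 3) (Ω : Set (ReconstructedDG.Rd d))
    (hΩ : ReconstructedDG.IsConvexPolytopalDomain Ω) (m : ℕ) (hm : 1 ≤ m) (N : ℕ)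
    (Cσ : ℝ) (hCσ : 0 < Cσ) :
    ∃ C : ℝ, 0 < C ∧
      ∀ T : ReconstructedDG.Triangulation Ω,
        T.meshSize ≤ Cσ * T.minInradius →
        N ≤ T.elements.card →
        T.Unisolvent m N →
        ∀ v : T.PiecewiseConst,
          T.energyNorm v.toBroken ≤ C * T.energyNorm (T.recon m N v) ∧
            T.energyNorm (T.recon m N v) ≤ C * T.Lambda m N * T.energyNorm v.toBroken := by
  have hd2 : 2 ≤ d := by lia
  have hc : 0 < (2 * Cσ)⁻¹ := by positivity
  obtain ⟨C₁, hC₁, h₁⟩ := ReconstructedDG.Triangulation.exists_energyNorm_le_recon d m N hd2 hc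
  obtain ⟨C₂, hC₂, h₂⟩ := ReconstructedDG.Triangulation.exists_energyNorm_recon_le d m N hd2 hc
  refine ⟨max C₁ C₂, lt_max_of_lt_left hC₁, fun T hmesh _ hu v => ?_⟩
  -- Some element exists because `Ω` is nonempty, so the mesh size and `Λ_m` are genuine extrema
  -- over elements.
  have := T.nonempty_elem hΩ
  obtain ⟨h, hT⟩ := ReconstructedDG.Triangulation.exists_isRegular (by lia) hCσ hmesh
  have hΛ := hT.one_le_lambda hu (Classical.arbitrary T.Elem)
  have h0 : 0 ≤ T.energyNorm v.toBroken := Real.sqrt_nonneg _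
  have h0' : 0 ≤ T.energyNorm (T.recon m N v) := Real.sqrt_nonneg _
  refine ⟨(h₁ Ω T h hT v).trans ?_, (h₂ Ω hΩ T h hT hu v).trans ?_⟩
  · gcongr
    exact le_max_left _ _
  · gcongr
    exact le_max_right _ _
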